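/- Let $X$ be a set with a generalized metric $d$ (values in $[0,\infty]$, otherwise the usual axioms) and a $\sigma$-finite measure $\mu$, let $\alpha\in(0,1]$, and let $C^{0,\alpha}(X)$ be the space of bounded $\alpha$-Hölder continuous functions $f:X\to\mathbb C$ with norm $\|f\|_\infty+\sup_{x\ne x'}|f(x)-f(x')|/d(x,x')^\alpha$. Let $V$ be a complex Hilbert space of measurable functions on $X$ that is densely and continuously embedded in $L^2(X)$ and also continuously embedded in $C^{0,\alpha}(X)$. Let $\mathfrak a:V\times V\to\mathbb C$ be a sesquilinear form that is bounded, $|\mathfrak a(u,v)|\le M\|u\|_V\|v\|_V$, and coercive with respect to $L^2(X)$, i.e. $\operatorname{Re}\mathfrak a(u,u)+\omega\|u\|_{L^2}^2\ge\eta\|u\|_V^2$ for all $u\in V$, with some $\omega\in\mathbb R$, $\eta>0$. Let $A$ be the associated operator on $L^2(X)$: $u\in D(A)$ and $Au=f$ if and only if $u\in V$, $f\in L^2(X)$ and $\mathfrak a(u,v)=-(f|v)_{L^2}$ for all $v\in V$. Then $A$ is closed and generates a strongly continuous semigroup $(\mathrm e^{tA})_{t\ge0}$ on $L^2(X)$,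 and there is a function $p:(0,\infty)\times X\times X\to\mathbb C$, the family of integral kernels of this semigroup, i.e. $(\mathrm e^{tA}f)(x)=\int_X p_t(x,y)f(y)\,d\mu(y)$ for all $t>0$, $f\in L^2(X)$ and a.e. $x$, that is a heat kernel associated with $A$: (a) each $p_t$ is measurable on $X\times X$, and $p_t(x,\cdot)f\in L^1(X)$ for all $t>0$, $f\in L^2(X)$ and a.e. $x$; (b) $x\mapsto\int_X p_t(x,y)f(y)\,d\mu(y)$ is in $L^2(X)$; (c) for a.e. $y$, the map $t\mapsto p_t(\cdot,y)$ is in $C^1((0,\infty);L^2(X))\cap C((0,\infty);D(A))$ and (d) satisfies $\frac{\partial}{\partial t}p_t(\cdot,y)=A\,p_t(\cdot,y)$ for all $t>0$; (e) $p_{t+s}(x,y)=\int_X p_t(x,z)p_s(z,y)\,d\mu(z)$ for all $s,t>0$ and a.e. $(x,y)$. Moreover: (i) For all $t>0$, $p_t\in C^{0,\alpha}(X\times X)$, where $X\times X$ carries the sum metric. (ii) If in addition $\mathfrak a$ is symmetric, $\mathfrak a(u,v)=\overline{\mathfrak a(v,u)}$, then for all $t>0$ the function $A_xA'_yp_t:X\times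 X\to\mathbb C$ is well defined and $\alpha$-Hölder continuous. Here $A_x$ is $A$ acting on the first variable, and $A'_y$ is the dual operator $A'$, given by $\int_X (Af)\,g\,d\mu=\int_X f\,(A'g)\,d\mu$ for all $f\in D(A)$, acting on the second variable. If moreover $\mathfrak a$ is real ($V$ is stable under complex conjugation and $\mathfrak a(\bar u,\bar v)=\overline{\mathfrak a(u,v)}$), so that $A'=A$, then $A_xA_yp_t$ is well defined and $\alpha$-Hölder continuous for all $t>0$. -/

import Mathlib

open MeasureTheory Filter Topology Set
open scoped NNReal ENNReal ComplexConjugate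

noncomputable section

namespace HeatKernel

/-! ### Hölder spaces -/

/-- The (extended) norm `‖f‖_∞ + |f|_{C^{0,α}}` of the space of bounded `α`-Hölder continuous
functions. It is finite exactly on that space. -/
def holderENorm {Z E : Type*} [PseudoEMetricSpace Z] [NormedAddCommGroup E]
    (α : ℝ≥0) (f : Z → E) : ℝ≥0∞ :=
  (⨆ z, ‖f z‖ₑ) + eHolderNorm α f

/-- A function `k` of two variables, regarded as a function on the product `X × X`
equipped with the sum metric `d((x,y),(x',y')) = d(x,x') + d(y,y')`. -/
def onSumMetric {X : Type*} (k : X → X → ℂ) : WithLp 1 (X × X) → ℂ :=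
  fun z => k z.fst z.snd

/-- The distance on `WithLp 1 (X × X)` is indeed the sum metric. -/
theorem edist_sumMetric {X : Type*} [PseudoEMetricSpace X] (z z' : WithLp 1 (X × X)) :
    edist z z' = edist z.fst z'.fst + edist z.snd z'.snd := by
  rw [WithLp.prod_edist_eq_add (by simp)]
  simp

section Measure

variable {X : Type*} [MeasurableSpace X] {μ : Measure X}

/-! ### Heat kernels -/

/-- `p` is a heat kernel associated with the closed linear operator `A` on `L^r(X, μ)`. Only the
values `p t` for `t > 0` matter. -/
structure IsHeatKernel {r : ℝ≥0∞} [Fact (1 ≤ r)]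
    (A : Lp ℂ r μ →ₗ.[ℂ] Lp ℂ r μ) (p : ℝ → X → X → ℂ) : Prop where
  closed : A.IsClosed
  measurable : ∀ t, 0 < t → Measurable (fun z : X × X => p t z.1 z.2)
  integrable : ∀ t, 0 < t → ∀ f : Lp ℂ r μ, ∀ᵐ x ∂μ, Integrable (fun y => p t x y * f y) μ
  memLp : ∀ t, 0 < t → ∀ f : Lp ℂ r μ, MemLp (fun x => ∫ y, p t x y * f y ∂μ) r μ
  /-- For a.e. `y`, the map `u : t ↦ p_t(·,y)` is of class `C^1((0,∞); L^r) ∩ C((0,∞); D(A))`,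
  with respect to the graph norm on `D(A)`, and solves `u' = A u`; here `u'` is the derivative. -/
  cauchy : ∀ᵐ y ∂μ, ∃ u u' : ℝ → Lp ℂ r μ,
    (∀ t, 0 < t → u t =ᵐ[μ] fun x => p t x y) ∧
    (∀ t, 0 < t → (u t, u' t) ∈ A.graph) ∧
    (∀ t, 0 < t → HasDerivAt u (u' t) t) ∧
    ContinuousOn u (Ioi 0) ∧ ContinuousOn u' (Ioi 0)
  semigroup : ∀ s t, 0 < s → 0 < t →
    ∀ᵐ z ∂(μ.prod μ), p (t + s) z.1 z.2 = ∫ w, p t z.1 w * p s w z.2 ∂μ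

/-- `(T t)_{t ≥ 0}` is a strongly continuous semigroup of bounded linear operators
whose generator is `A`, i.e. `T t = e^{tA}`. -/
structure IsSemigroupGeneratedBy {E : Type*} [NormedAddCommGroup E] [NormedSpace ℂ E]
    (A : E →ₗ.[ℂ] E) (T : ℝ → E →L[ℂ] E) : Prop where
  zero : T 0 = ContinuousLinearMap.id ℂ E
  add : ∀ s t, 0 ≤ s → 0 ≤ t → T (s + t) = (T s).comp (T t)
  strongly_continuous : ∀ f, Tendsto (fun t => T t f) (𝓝[>] 0) (𝓝 f)
  generator : ∀ f g, (f, g) ∈ A.graph ↔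
    Tendsto (fun h : ℝ => ((h : ℂ))⁻¹ • (T h f - f)) (𝓝[>] 0) (𝓝 g)

/-- `p` is the family of integral kernels of the operators `T t`, `t > 0`. -/
def IsKernelOf {r : ℝ≥0∞} [Fact (1 ≤ r)]
    (T : ℝ → Lp ℂ r μ →L[ℂ] Lp ℂ r μ) (p : ℝ → X → X → ℂ) : Prop :=
  ∀ t, 0 < t → ∀ f : Lp ℂ r μ, T t f =ᵐ[μ] fun x => ∫ y, p t x y * f y ∂μ

/-- The graph of the dual operator `A'` of `A` for the bilinear pairing `∫ f g dμ` of `L²(X)` with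
itself: `(g, A'g)` is characterized by `∫ (A f) g dμ = ∫ f (A'g) dμ` for all `f ∈ D(A)`. For a
densely defined `A` this determines `A'g`. -/
def dualGraph (A : Lp ℂ 2 μ →ₗ.[ℂ] Lp ℂ 2 μ) : Set (Lp ℂ 2 μ × Lp ℂ 2 μ) :=
  {q | ∀ f g : Lp ℂ 2 μ, (f, g) ∈ A.graph → ∫ x, g x * q.1 x ∂μ = ∫ x, f x * q.2 x ∂μ}

/-- With `A_x` acting on the first variable through the operator `A`, and `B_y` acting
on the second variable through the operator with graph `Gy`, the function `A_x B_y k` is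
well-defined and `α`-Hölder continuous on `X × X`. Here `q = B_y k` and `w = A_x B_y k`. -/
def MixedHolder [PseudoEMetricSpace X] (α : ℝ≥0)
    (A : Lp ℂ 2 μ →ₗ.[ℂ] Lp ℂ 2 μ) (Gy : Set (Lp ℂ 2 μ × Lp ℂ 2 μ)) (k : X → X → ℂ) : Prop :=
  ∃ q w : X → X → ℂ,
    Measurable (fun z : X × X => q z.1 z.2) ∧ Measurable (fun z : X × X => w z.1 z.2) ∧
    (∀ x, ∃ f g : Lp ℂ 2 μ, f =ᵐ[μ] (fun y => k x y) ∧ g =ᵐ[μ] (fun y => q x y) ∧ (f, g) ∈ Gy) ∧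
    (∀ y, ∃ f g : Lp ℂ 2 μ, f =ᵐ[μ] (fun x => q x y) ∧ g =ᵐ[μ] (fun x => w x y) ∧ (f, g) ∈ A.graph) ∧
    MemHolder α (onSumMetric w)

end Measure

/-! ### Sesquilinear forms -/

section Form

variable {V H : Type*} [NormedAddCommGroup V] [InnerProductSpace ℂ V]
  [NormedAddCommGroup H] [InnerProductSpace ℂ H]

/-- `|a(u,v)| ≤ M ‖u‖ ‖v‖` -/
def FormBounded (a : V →ₗ[ℂ] V →ₗ⋆[ℂ] ℂ) : Prop :=
  ∃ M : ℝ, ∀ u v, ‖a u v‖ ≤ M * ‖u‖ * ‖v‖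

/-- The form `a` on `V` is coercive with respect to the space `H` in which `V` is embedded by `j`:
`Re a(u,u) + ω ‖u‖²_H ≥ η ‖u‖²_V` for some `ω ∈ ℝ`, `η > 0`. -/
def FormCoercive (j : V →L[ℂ] H) (a : V →ₗ[ℂ] V →ₗ⋆[ℂ] ℂ) : Prop :=
  ∃ ω η : ℝ, 0 < η ∧ ∀ u, η * ‖u‖ ^ 2 ≤ (a u u).re + ω * ‖j u‖ ^ 2

/-- `a(u,v)` is the conjugate of `a(v,u)`. -/
def FormSymmetric (a : V →ₗ[ℂ] V →ₗ⋆[ℂ] ℂ) : Prop :=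
  ∀ u v, a u v = conj (a v u)

/-- The form `a` on a space `V` of functions (`ι v` is the function that `v` is) is real: `V` is
stable under complex conjugation, and `a` maps conjugates to conjugates. -/
def FormReal {X : Type*} (ι : V →ₗ[ℂ] (X → ℂ)) (a : V →ₗ[ℂ] V →ₗ⋆[ℂ] ℂ) : Prop :=
  (∀ u, ∃ u', ∀ x, ι u' x = conj (ι u x)) ∧
  ∀ u u' v v', (∀ x, ι u' x = conj (ι u x)) → (∀ x, ι v' x = conj (ι v x)) →
    a u' v' = conj (a u v)

/-- The graph of the operator associated with `a`:
all pairs `(u, f)` with `u ∈ V`, `f ∈ H` and `a(u,v) = -(f|v)_H` for all `v ∈ V`. -/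
def formGraph (j : V →L[ℂ] H) (a : V →ₗ[ℂ] V →ₗ⋆[ℂ] ℂ) : Submodule ℂ (H × H) where
  carrier := {q | ∃ u : V, j u = q.1 ∧ ∀ v, a u v = -inner ℂ (j v) q.2}
  zero_mem' := ⟨0, by simp, by simp⟩
  add_mem' := by
    rintro q q' ⟨u, hu, h⟩ ⟨u', hu', h'⟩
    refine ⟨u + u', by simp [hu, hu'], fun v => ?_⟩
    simp [h, h']
    ring
  smul_mem' := by
    rintro c q ⟨u, hu, h⟩
    refine ⟨c • u, by simp [hu], fun v => ?_⟩
    simp [h]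

/-- The operator `A` associated with `a` (with the sign for which `A` generates `e^{tA}`). -/
def formOperator (j : V →L[ℂ] H) (a : V →ₗ[ℂ] V →ₗ⋆[ℂ] ℂ) : H →ₗ.[ℂ] H :=
  (formGraph j a).toLinearPMap

/-- For a densely embedded form domain, the operator is given by its graph, as it should. -/
theorem mem_formOperator_graph (j : V →L[ℂ] H) (hj : Function.Injective j) (hd : DenseRange j)
    (a : V →ₗ[ℂ] V →ₗ⋆[ℂ] ℂ) (u f : H) :
    (u, f) ∈ (formOperator j a).graph ↔ ∃ v : V, j v = u ∧ ∀ w, a v w = -inner ℂ (j w) f := by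
  rw [formOperator, Submodule.toLinearPMap_graph_eq]
  · rfl
  rintro ⟨q1, q2⟩ ⟨v, hv, h⟩ h0
  simp only at hv h0 h
  have hv0 : v = 0 := hj (by rw [hv, h0, map_zero])
  subst hv0
  refine hd.eq_zero_of_inner_right (𝕜 := ℂ) fun w => ?_
  simpa using (h w).symm

end Form

end HeatKernel

end

/-!
The form is reduced to bounded operators. After the shift by `ω`, Lax–Milgram represents
`a(u,v) + ω (u|v)` by an invertible operator `N` on `V`, and `R = j N⁻¹ j*` is a bounded, injective
operator on `L²(X)` with dense range whose numerical range lies in a sector `|Im w| ≤ K Re w`. The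
operator associated with `a` is `A = ω - R⁻¹` (`mem_formOperator_graph_iff`).

The semigroup `exp (-z R⁻¹)` is the limit of `exp (-z (R + ε)⁻¹)` as `ε → 0`. Sectoriality makes
these exponentials contractions for all `z` in the polar sector, and on the dense range of `R²` they
are Cauchy, uniformly for bounded `z`. Hence the limit exists, is strongly continuous up to `0` and
is holomorphic inside the sector (`Sectorial.exists_isSmoothSemigroup`). In particular
`C t = R⁻¹ exp (-t R⁻¹)` is bounded for `t > 0`, and so are `R⁻² exp (-t R⁻¹) = C (t/2) C (t/2)` and
all higher powers.

Point evaluations on `V` are represented by vectors `d x ∈ V`, and `x ↦ d x` is bounded and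
`α`-Hölder continuous. An operator `R B R` with `B` bounded on `L²(X)` factors through `V` on both
sides, so its integral kernel is `(d x | N⁻¹ j* B j N⁻¹ d y)` at every pair of points, and this is
bounded and `α`-Hölder continuous for the sum metric. It is jointly measurable because `V` is
separable (`countable_of_orthonormal_of_evaluation`). Since
`e^{tA} = R (e^{ωt} C (t/2) C (t/2)) R`, the semigroup has such a kernel. Applying `A` in `x` or
`A'` in `y` replaces `B` by another bounded operator, as `A R = ω R - 1`, and the kernel stays of
the same form (`mixedHolder_heatKernel`).
-/

/-! ### Dissipative and sectorial operators -/

namespace HeatKernel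

section Semigroup

/-- Dissipative operators generate contractions. -/
theorem norm_exp_apply_le_of_dissipative {H : Type*} [NormedAddCommGroup H] [InnerProductSpace ℂ H]
    [CompleteSpace H] (P : H →L[ℂ] H) (hP : ∀ f, (inner ℂ f (P f)).re ≤ 0)
    (f : H) : ‖NormedSpace.exp P f‖ ≤ ‖f‖ := by
  have hu : ∀ s : ℝ, HasDerivAt (fun s : ℝ => NormedSpace.exp (s • P) f)
      (P (NormedSpace.exp (s • P) f)) s := fun s =>
    (ContinuousLinearMap.apply ℂ H f).restrictScalars ℝ |>.hasFDerivAt.comp_hasDerivAt s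
      (hasDerivAt_exp_smul_const' (𝕂 := ℝ) P s)
  have hd : ∀ s : ℝ, HasDerivAt (fun s : ℝ => ‖NormedSpace.exp (s • P) f‖ ^ 2)
      (2 * (inner ℂ (NormedSpace.exp (s • P) f) (P (NormedSpace.exp (s • P) f))).re) s :=
    fun s => by
      have h : HasDerivAt
          (fun r : ℝ => (inner ℂ (NormedSpace.exp (r • P) f) (NormedSpace.exp (r • P) f)).re)
          (inner ℂ (NormedSpace.exp (s • P) f) (P (NormedSpace.exp (s • P) f)) +
            inner ℂ (P (NormedSpace.exp (s • P) f)) (NormedSpace.exp (s • P) f)).re s :=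
        Complex.reCLM.hasFDerivAt.comp_hasDerivAt s ((hu s).inner ℂ (hu s))
      have e : ∀ g : H, (inner ℂ g g).re = ‖g‖ ^ 2 := inner_self_eq_norm_sq (𝕜 := ℂ)
      simp only [e] at h
      refine h.congr_deriv ?_
      rw [Complex.add_re, ← inner_conj_symm (P (NormedSpace.exp (s • P) f)), Complex.conj_re]
      ring
  have hanti : Antitone (fun s : ℝ => ‖NormedSpace.exp (s • P) f‖ ^ 2) :=
    antitone_of_deriv_nonpos (fun s => (hd s).differentiableAt) fun s => by
      rw [(hd s).deriv]
      linarith [hP (NormedSpace.exp (s • P) f)]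
  have h01 := hanti (zero_le_one (α := ℝ))
  simp only [one_smul, zero_smul, NormedSpace.exp_zero, one_apply_eq_self] at h01
  exact (pow_le_pow_iff_left₀ (norm_nonneg _) (norm_nonneg _) two_ne_zero).1 h01

/-- The Duhamel estimate for two commuting dissipative operators. -/
theorem norm_exp_sub_exp_apply_le {H : Type*} [NormedAddCommGroup H] [InnerProductSpace ℂ H]
    [CompleteSpace H] (P Q : H →L[ℂ] H) (hPQ : Commute P Q)
    (hP : ∀ f, (inner ℂ f (P f)).re ≤ 0) (hQ : ∀ f, (inner ℂ f (Q f)).re ≤ 0) (f : H) :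
    ‖NormedSpace.exp P f - NormedSpace.exp Q f‖ ≤ ‖P f - Q f‖ := by
  have hd : ∀ s : ℝ, HasDerivAt
      (fun s : ℝ => (NormedSpace.exp (s • P) * NormedSpace.exp ((1 - s) • Q)) f)
      (NormedSpace.exp (s • P) (NormedSpace.exp ((1 - s) • Q) (P f - Q f))) s := fun s => by
    have h1 := hasDerivAt_exp_smul_const (𝕂 := ℝ) P s
    have h2 := (hasDerivAt_exp_smul_const (𝕂 := ℝ) Q (1 - s)).scomp s
      ((hasDerivAt_id s).const_sub 1)
    have h3 := (ContinuousLinearMap.apply ℂ H f).restrictScalars ℝ |>.hasFDerivAt.comp_hasDerivAt s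
      (h1.mul h2)
    have e : NormedSpace.exp (s • P) * P * NormedSpace.exp ((1 - s) • Q) +
        NormedSpace.exp (s • P) * (-1 : ℝ) • (NormedSpace.exp ((1 - s) • Q) * Q) =
        NormedSpace.exp (s • P) * (NormedSpace.exp ((1 - s) • Q) * (P - Q)) := by
      rw [mul_assoc, ((hPQ.smul_right (1 - s)).exp_right).eq, neg_one_smul, mul_sub, mul_sub]
      noncomm_ring
    exact h3.congr_deriv (congrArg (fun T : H →L[ℂ] H => T f) e)
  have hsP : ∀ s : ℝ, 0 ≤ s → ∀ (P : H →L[ℂ] H), (∀ f, (inner ℂ f (P f)).re ≤ 0) →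
      ∀ f, (inner ℂ f ((s • P) f)).re ≤ 0 := fun s hs P hP f => by
    have : (s • P) f = (s : ℂ) • P f := by simp
    rw [this, inner_smul_right, Complex.re_ofReal_mul]
    exact mul_nonpos_of_nonneg_of_nonpos hs (hP f)
  have := norm_image_sub_le_of_norm_deriv_le_segment_01' (C := ‖P f - Q f‖)
    (fun s _ => (hd s).hasDerivWithinAt) fun s hs =>
      (norm_exp_apply_le_of_dissipative _ (hsP s hs.1 P hP) _).trans
        (norm_exp_apply_le_of_dissipative _ (hsP (1 - s) (by linarith [hs.2]) Q hQ) _)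
  simpa using this

/-- The numerical range of `R` lies in the closed sector `|Im w| ≤ K Re w` of the right half
plane. -/
def Sectorial {H : Type*} [NormedAddCommGroup H] [InnerProductSpace ℂ H]
    (K : ℝ) (R : H →L[ℂ] H) : Prop :=
  0 ≤ K ∧ ∀ f, 0 ≤ (inner ℂ f (R f)).re ∧ |(inner ℂ f (R f)).im| ≤ K * (inner ℂ f (R f)).re

/-- The closed sector polar to the one in `Sectorial`: `Re (z w) ≥ 0` for every `z` in it and
every `w` with `|Im w| ≤ K Re w`. -/
def polarSector (K : ℝ) : Set ℂ := {z | K * |z.im| ≤ z.re}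

theorem Sectorial.re_inner_smul_nonneg {H : Type*} [NormedAddCommGroup H] [InnerProductSpace ℂ H]
    {K : ℝ} {R : H →L[ℂ] H} (hR : Sectorial K R) {z : ℂ}
    (hz : z ∈ polarSector K) (f : H) : 0 ≤ (inner ℂ f ((z • R) f)).re := by
  obtain ⟨h0, h1⟩ := hR.2 f
  rw [smul_apply, inner_smul_right, Complex.mul_re]
  have hz' : K * |z.im| ≤ z.re := hz
  have h2 : z.im * (inner ℂ f (R f)).im ≤ |z.im| * (K * (inner ℂ f (R f)).re) :=
    (le_abs_self _).trans ((abs_mul _ _).le.trans (mul_le_mul_of_nonneg_left h1 (abs_nonneg _)))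
  nlinarith [mul_le_mul_of_nonneg_right hz' h0]

theorem isUnit_of_coercive {V : Type*} [NormedAddCommGroup V] [InnerProductSpace ℂ V]
    [CompleteSpace V] (N : V →L[ℂ] V) {η : ℝ} (hη : 0 < η)
    (h : ∀ u, η * ‖u‖ ^ 2 ≤ (inner ℂ u (N u)).re) : IsUnit N := by
  refine N.isUnit_of_forall_le_norm_inner_map (c := ⟨η, hη.le⟩) hη fun u => ?_
  rw [← norm_inner_symm, mul_comm]
  exact (h u).trans (Complex.re_le_norm _)

/-- The regularized inverse `(R + ε)⁻¹`; if `R⁻¹ = -A`, this is minus the Yosida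
approximation of `A`. -/
noncomputable def regInv {H : Type*} [NormedAddCommGroup H] [InnerProductSpace ℂ H]
    (R : H →L[ℂ] H) (ε : ℝ) : H →L[ℂ] H :=
  Ring.inverse (R + (ε : ℂ) • 1)

theorem Sectorial.le_re_inner_add {H : Type*} [NormedAddCommGroup H] [InnerProductSpace ℂ H]
    {K : ℝ} {R : H →L[ℂ] H} (hR : Sectorial K R) (ε : ℝ) (f : H) :
    ε * ‖f‖ ^ 2 ≤ (inner ℂ f ((R + (ε : ℂ) • (1 : H →L[ℂ] H)) f)).re := by
  have h : (inner ℂ f f).re = ‖f‖ ^ 2 := inner_self_eq_norm_sq (𝕜 := ℂ) f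
  have e : (R + (ε : ℂ) • (1 : H →L[ℂ] H)) f = R f + (ε : ℂ) • f := rfl
  rw [e, inner_add_right, inner_smul_right, Complex.add_re, Complex.re_ofReal_mul, h]
  linarith [(hR.2 f).1]

theorem commute_regInv_regInv {H : Type*} [NormedAddCommGroup H] [InnerProductSpace ℂ H]
    (R : H →L[ℂ] H) (ε ε' : ℝ) :
    Commute (regInv R ε) (regInv R ε') := by
  refine Commute.ringInverse_ringInverse (Commute.add_left ?_ ?_)
  · exact (Commute.refl R).add_right ((Commute.one_right R).smul_right _)
  · exact (Commute.one_left _).smul_left _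

variable {H : Type*} [NormedAddCommGroup H] [InnerProductSpace ℂ H] [CompleteSpace H]

theorem Sectorial.isUnit_add {K : ℝ} {R : H →L[ℂ] H} (hR : Sectorial K R) {ε : ℝ} (hε : 0 < ε) :
    IsUnit (R + (ε : ℂ) • (1 : H →L[ℂ] H)) :=
  isUnit_of_coercive _ hε (hR.le_re_inner_add ε)

theorem Sectorial.regInv_add {K : ℝ} {R : H →L[ℂ] H} (hR : Sectorial K R) {ε : ℝ} (hε : 0 < ε)
    (f : H) : R (regInv R ε f) + (ε : ℂ) • regInv R ε f = f :=
  congrArg (fun T : H →L[ℂ] H => T f) (Ring.mul_inverse_cancel _ (hR.isUnit_add hε))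

theorem Sectorial.regInv_apply {K : ℝ} {R : H →L[ℂ] H} (hR : Sectorial K R) {ε : ℝ} (hε : 0 < ε)
    (f : H) : regInv R ε (R f) = f - (ε : ℂ) • regInv R ε f := by
  have : regInv R ε (R f + (ε : ℂ) • f) = f :=
    congrArg (fun T : H →L[ℂ] H => T f) (Ring.inverse_mul_cancel _ (hR.isUnit_add hε))
  rw [map_add, map_smul] at this
  exact eq_sub_of_add_eq this

theorem Sectorial.commute_regInv {K : ℝ} {R : H →L[ℂ] H} (hR : Sectorial K R) {ε : ℝ}
    (hε : 0 < ε) : Commute R (regInv R ε) := by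
  ext f
  exact (eq_sub_of_add_eq (hR.regInv_add hε f)).trans (hR.regInv_apply hε f).symm

theorem Sectorial.norm_smul_regInv_le {K : ℝ} {R : H →L[ℂ] H} (hR : Sectorial K R) {ε : ℝ}
    (hε : 0 < ε) (f : H) : ‖(ε : ℂ) • regInv R ε f‖ ≤ ‖f‖ := by
  have h1 : ε * ‖regInv R ε f‖ ^ 2 ≤ ‖regInv R ε f‖ * ‖f‖ := by
    have h2 := hR.le_re_inner_add ε (regInv R ε f)
    have h3 : (R + (ε : ℂ) • (1 : H →L[ℂ] H)) (regInv R ε f) = f := hR.regInv_add hε f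
    rw [h3] at h2
    exact h2.trans ((Complex.re_le_norm _).trans (norm_inner_le_norm _ _))
  rw [norm_smul, Complex.norm_real, Real.norm_of_nonneg hε.le]
  rcases (norm_nonneg (regInv R ε f)).eq_or_lt with h0 | h0
  · simp [← h0]
  · exact le_of_mul_le_mul_left (by nlinarith) h0

theorem Sectorial.sectorial_regInv {K : ℝ} {R : H →L[ℂ] H} (hR : Sectorial K R) {ε : ℝ}
    (hε : 0 < ε) : Sectorial K (regInv R ε) := by
  refine ⟨hR.1, fun f => ?_⟩
  -- with `g = (R + ε)⁻¹ f`, the number `⟨f, g⟩` is the conjugate of `⟨g, R g⟩` plus `ε ‖g‖²`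
  have h4 : inner ℂ f (regInv R ε f) = conj (inner ℂ (regInv R ε f) (R (regInv R ε f))) +
      ((ε * ‖regInv R ε f‖ ^ 2 : ℝ) : ℂ) := by
    have h3 : inner ℂ f (regInv R ε f) =
        inner ℂ (R (regInv R ε f) + (ε : ℂ) • regInv R ε f) (regInv R ε f) := by
      rw [hR.regInv_add hε f]
    rw [h3, inner_add_left, inner_smul_left, inner_self_eq_norm_sq_to_K, inner_conj_symm]
    simp
  obtain ⟨h5, h6⟩ := hR.2 (regInv R ε f)
  have h7 : 0 ≤ ε * ‖regInv R ε f‖ ^ 2 := by positivity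
  rw [h4]
  simp only [Complex.add_re, Complex.conj_re, Complex.ofReal_re, Complex.add_im, Complex.conj_im,
    Complex.ofReal_im, add_zero, abs_neg]
  exact ⟨by positivity, h6.trans (mul_le_mul_of_nonneg_left (by linarith) hR.1)⟩

end Semigroup

/-! ### Holomorphic exponentials of the inverse of a sectorial operator -/

section Limit

/-- The approximating exponentials `exp (-z (R + εₙ)⁻¹)` with `εₙ = 1 / (n + 1)`. -/
noncomputable def regExp {H : Type*} [NormedAddCommGroup H] [InnerProductSpace ℂ H]
    (R : H →L[ℂ] H) (n : ℕ) (z : ℂ) : H →L[ℂ] H :=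
  NormedSpace.exp (z • (-regInv R (1 / ((n : ℝ) + 1))))

/-- The limit of `regExp R n z` as `n → ∞`, that is, `exp (-z R⁻¹)`. It is meaningful for `z` in
the polar sector of `R` only. -/
noncomputable def sectorExp {H : Type*} [NormedAddCommGroup H] [InnerProductSpace ℂ H]
    (R : H →L[ℂ] H) (z : ℂ) (f : H) : H :=
  limUnder atTop fun n => regExp R n z f

theorem zero_mem_polarSector (K : ℝ) : (0 : ℂ) ∈ polarSector K := by simp [polarSector]

theorem add_mem_polarSector {K : ℝ} (hK : 0 ≤ K) {z w : ℂ} (hz : z ∈ polarSector K)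
    (hw : w ∈ polarSector K) : z + w ∈ polarSector K := by
  have h1 : K * |z.im| ≤ z.re := hz
  have h2 : K * |w.im| ≤ w.re := hw
  have h3 := mul_le_mul_of_nonneg_left (abs_add_le z.im w.im) hK
  change K * |(z + w).im| ≤ (z + w).re
  rw [Complex.add_im, Complex.add_re]
  linarith

theorem ofReal_mem_polarSector (K : ℝ) {t : ℝ} (ht : 0 ≤ t) : (t : ℂ) ∈ polarSector K := by
  simp [polarSector, ht]

/-- The interior of the polar sector. -/
def openPolarSector (K : ℝ) : Set ℂ := {z | K * |z.im| < z.re}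

theorem isOpen_openPolarSector (K : ℝ) : IsOpen (openPolarSector K) :=
  isOpen_lt (continuous_const.mul Complex.continuous_im.abs) Complex.continuous_re

theorem openPolarSector_subset (K : ℝ) : openPolarSector K ⊆ polarSector K :=
  fun z (hz : K * |z.im| < z.re) => hz.le

theorem ofReal_mem_openPolarSector (K : ℝ) {t : ℝ} (ht : 0 < t) :
    (t : ℂ) ∈ openPolarSector K := by
  simp [openPolarSector, ht]

variable {H : Type*} [NormedAddCommGroup H] [InnerProductSpace ℂ H] [CompleteSpace H]
  {K : ℝ} {R : H →L[ℂ] H}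

theorem Sectorial.norm_regExp_le (hR : Sectorial K R) (n : ℕ) {z : ℂ} (hz : z ∈ polarSector K)
    (f : H) : ‖regExp R n z f‖ ≤ ‖f‖ := by
  refine norm_exp_apply_le_of_dissipative _ (fun g => ?_) f
  have := (hR.sectorial_regInv (Nat.one_div_pos_of_nat (n := n))).re_inner_smul_nonneg hz g
  rw [smul_neg, neg_apply, inner_neg_right, Complex.neg_re]
  exact neg_nonpos.2 this

theorem Sectorial.norm_regExp_sub_le (hR : Sectorial K R) (n m : ℕ) {z : ℂ}
    (hz : z ∈ polarSector K) (f : H) : ‖regExp R n z f - regExp R m z f‖ ≤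
      ‖z‖ * ‖regInv R (1 / ((n : ℝ) + 1)) f - regInv R (1 / ((m : ℝ) + 1)) f‖ := by
  have hd : ∀ n : ℕ, ∀ g, (inner ℂ g ((z • (-regInv R (1 / ((n : ℝ) + 1)))) g)).re ≤ 0 :=
    fun n g => by
      have := (hR.sectorial_regInv (Nat.one_div_pos_of_nat (n := n))).re_inner_smul_nonneg hz g
      rw [smul_neg, neg_apply, inner_neg_right, Complex.neg_re]
      exact neg_nonpos.2 this
  refine (norm_exp_sub_exp_apply_le _ _ ?_ (hd n) (hd m) f).trans (le_of_eq ?_)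
  · exact ((commute_regInv_regInv R _ _).neg_left.neg_right.smul_left z).smul_right z
  · rw [← norm_smul, ← norm_neg, smul_sub]
    simp only [smul_apply, neg_apply, smul_neg]
    congr 1
    abel

theorem Sectorial.tendsto_smul_regInv (hR : Sectorial K R) (hd : DenseRange R) (f : H) :
    Tendsto (fun n : ℕ => ((1 / ((n : ℝ) + 1) : ℝ) : ℂ) • regInv R (1 / ((n : ℝ) + 1)) f) atTop
      (𝓝 0) := by
  rw [Metric.tendsto_atTop]
  intro δ hδ
  obtain ⟨k, hk⟩ := hd.exists_dist_lt f (half_pos hδ)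
  have hlim : Tendsto (fun n : ℕ => 1 / ((n : ℝ) + 1) * (2 * ‖k‖)) atTop (𝓝 0) := by
    simpa using tendsto_one_div_add_atTop_nhds_zero_nat.mul_const (2 * ‖k‖)
  obtain ⟨N, hN⟩ := eventually_atTop.1 (hlim.eventually (gt_mem_nhds (half_pos hδ)))
  refine ⟨N, fun n hn => ?_⟩
  have hε : 0 < 1 / ((n : ℝ) + 1) := Nat.one_div_pos_of_nat
  specialize hN n hn
  set ε := 1 / ((n : ℝ) + 1)
  have e : (ε : ℂ) • regInv R ε f = (ε : ℂ) • regInv R ε (f - R k) +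
      (ε : ℂ) • (k - (ε : ℂ) • regInv R ε k) := by
    rw [← hR.regInv_apply hε, ← smul_add, ← map_add, sub_add_cancel]
  have h1 := hR.norm_smul_regInv_le hε (f - R k)
  have h2 : ‖(ε : ℂ) • (k - (ε : ℂ) • regInv R ε k)‖ ≤ ε * (2 * ‖k‖) := by
    rw [norm_smul, Complex.norm_real, Real.norm_of_nonneg hε.le]
    refine mul_le_mul_of_nonneg_left ?_ hε.le
    linarith [norm_sub_le k ((ε : ℂ) • regInv R ε k), hR.norm_smul_regInv_le hε k]
  rw [dist_zero_right, e]
  rw [dist_eq_norm] at hk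
  linarith [norm_add_le ((ε : ℂ) • regInv R ε (f - R k))
    ((ε : ℂ) • (k - (ε : ℂ) • regInv R ε k))]

/-- On the range of `R²` the approximations `(R + ε)⁻¹` of `R⁻¹` converge at rate `ε`. -/
theorem Sectorial.norm_regInv_sq_sub_le (hR : Sectorial K R) {ε : ℝ} (hε : 0 < ε) (h : H) :
    ‖regInv R ε (R (R h)) - R h‖ ≤ ε * (2 * ‖h‖) := by
  rw [hR.regInv_apply hε, hR.regInv_apply hε, sub_sub_cancel_left, norm_neg, norm_smul,
    Complex.norm_real, Real.norm_of_nonneg hε.le]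
  refine mul_le_mul_of_nonneg_left ?_ hε.le
  linarith [norm_sub_le h ((ε : ℂ) • regInv R ε h), hR.norm_smul_regInv_le hε h]

theorem Sectorial.uniformCauchySeqOn_regExp (hR : Sectorial K R) (hd : DenseRange R) (f : H)
    (r : ℝ) : UniformCauchySeqOn (fun n z => regExp R n z f) atTop
      (polarSector K ∩ Metric.closedBall 0 r) := by
  rw [Metric.uniformCauchySeqOn_iff]
  intro δ hδ
  -- by contractivity it suffices to treat a vector `R (R h)` close to `f`
  obtain ⟨h, hh⟩ := (hd.comp hd R.continuous).exists_dist_lt f (show 0 < δ / 4 by linarith)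
  rw [dist_eq_norm, Function.comp_apply] at hh
  have hlim : Tendsto (fun n : ℕ => r * (1 / ((n : ℝ) + 1) * (2 * ‖h‖))) atTop (𝓝 0) := by
    simpa using (tendsto_one_div_add_atTop_nhds_zero_nat.mul_const (2 * ‖h‖)).const_mul r
  obtain ⟨N, hN⟩ := eventually_atTop.1
    (hlim.eventually (gt_mem_nhds (show 0 < δ / 4 by linarith)))
  refine ⟨N, fun m hm n hn z hz => ?_⟩
  have hr : ‖z‖ ≤ r := by simpa using hz.2
  have h1 : ∀ k, ‖regExp R k z (f - R (R h))‖ < δ / 4 := fun k =>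
    (hR.norm_regExp_le k hz.1 _).trans_lt hh
  have h2 : ‖regExp R m z (R (R h)) - regExp R n z (R (R h))‖ < δ / 2 := by
    refine (hR.norm_regExp_sub_le m n hz.1 _).trans_lt ?_
    have h3 := hR.norm_regInv_sq_sub_le (Nat.one_div_pos_of_nat (n := m)) h
    have h4 := hR.norm_regInv_sq_sub_le (Nat.one_div_pos_of_nat (n := n)) h
    have h5 := norm_sub_le_norm_sub_add_norm_sub (regInv R (1 / ((m : ℝ) + 1)) (R (R h))) (R h)
      (regInv R (1 / ((n : ℝ) + 1)) (R (R h)))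
    rw [norm_sub_rev (R h)] at h5
    have h6 := mul_le_mul hr (h5.trans (add_le_add h3 h4)) (norm_nonneg _)
      ((norm_nonneg z).trans hr)
    rw [mul_add] at h6
    linarith [hN m hm, hN n hn]
  have e : ∀ k, regExp R k z f = regExp R k z (f - R (R h)) + regExp R k z (R (R h)) := fun k => by
    rw [← map_add, sub_add_cancel]
  rw [dist_eq_norm, e m, e n, add_sub_add_comm]
  linarith [norm_add_le (regExp R m z (f - R (R h)) - regExp R n z (f - R (R h)))
    (regExp R m z (R (R h)) - regExp R n z (R (R h))),
    norm_sub_le (regExp R m z (f - R (R h))) (regExp R n z (f - R (R h))), h1 m, h1 n]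

theorem Sectorial.tendsto_regExp (hR : Sectorial K R) (hd : DenseRange R) {z : ℂ}
    (hz : z ∈ polarSector K) (f : H) :
    Tendsto (fun n => regExp R n z f) atTop (𝓝 (sectorExp R z f)) :=
  ((hR.uniformCauchySeqOn_regExp hd f ‖z‖).cauchySeq ⟨hz, by simp⟩).tendsto_limUnder

theorem Sectorial.tendstoLocallyUniformlyOn_regExp (hR : Sectorial K R) (hd : DenseRange R)
    (f : H) : TendstoLocallyUniformlyOn (fun n z => regExp R n z f) (fun z => sectorExp R z f)
      atTop (polarSector K) := by
  rw [Metric.tendstoLocallyUniformlyOn_iff]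
  intro δ hδ z hz
  have h := (hR.uniformCauchySeqOn_regExp hd f (‖z‖ + 1)).tendstoUniformlyOn_of_tendsto
    fun w hw => hR.tendsto_regExp hd hw.1 f
  refine ⟨_, inter_mem_nhdsWithin _ (Metric.closedBall_mem_nhds z one_pos), ?_⟩
  filter_upwards [Metric.tendstoUniformlyOn_iff.1 h δ hδ] with n hn w hw
  refine hn w ⟨hw.1, ?_⟩
  have h1 : ‖w - z‖ ≤ 1 := by simpa [dist_eq_norm] using hw.2
  have h2 := norm_add_le (w - z) z
  rw [sub_add_cancel] at h2
  simpa using (by linarith : ‖w‖ ≤ ‖z‖ + 1)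

theorem hasDerivAt_regExp (R : H →L[ℂ] H) (n : ℕ) (f : H) (z : ℂ) :
    HasDerivAt (fun z => regExp R n z f)
      (regExp R n z (-regInv R (1 / ((n : ℝ) + 1)) f)) z :=
  (ContinuousLinearMap.apply ℂ H f).hasFDerivAt.comp_hasDerivAt z
    (hasDerivAt_exp_smul_const (𝕂 := ℂ) _ z)

theorem Sectorial.continuousOn_sectorExp (hR : Sectorial K R) (hd : DenseRange R) (f : H) :
    ContinuousOn (fun z => sectorExp R z f) (polarSector K) :=
  (hR.tendstoLocallyUniformlyOn_regExp hd f).continuousOn <| Frequently.of_forall fun n z _ =>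
    (hasDerivAt_regExp R n f z).continuousAt.continuousWithinAt

theorem Sectorial.differentiableOn_sectorExp (hR : Sectorial K R) (hd : DenseRange R) (f : H) :
    DifferentiableOn ℂ (fun z => sectorExp R z f) (openPolarSector K) :=
  ((hR.tendstoLocallyUniformlyOn_regExp hd f).mono (openPolarSector_subset K)).differentiableOn
    (Eventually.of_forall fun n z _ =>
      (hasDerivAt_regExp R n f z).differentiableAt.differentiableWithinAt)
    (isOpen_openPolarSector K)

theorem Sectorial.norm_sectorExp_le (hR : Sectorial K R) (hd : DenseRange R) {z : ℂ}
    (hz : z ∈ polarSector K) (f : H) : ‖sectorExp R z f‖ ≤ ‖f‖ :=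
  le_of_tendsto (hR.tendsto_regExp hd hz f).norm
    (Eventually.of_forall fun n => hR.norm_regExp_le n hz f)

/-- Contractivity makes the convergence of `regExp R n z` joint in the vector. -/
theorem Sectorial.tendsto_regExp_apply (hR : Sectorial K R) (hd : DenseRange R) {z : ℂ}
    (hz : z ∈ polarSector K) {u : ℕ → H} {f : H} (hu : Tendsto u atTop (𝓝 f)) :
    Tendsto (fun n => regExp R n z (u n)) atTop (𝓝 (sectorExp R z f)) := by
  have h0 : Tendsto (fun n => regExp R n z (u n - f)) atTop (𝓝 0) :=
    squeeze_zero_norm (fun n => hR.norm_regExp_le n hz _)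
      (by simpa using (hu.sub_const f).norm)
  simpa using h0.add (hR.tendsto_regExp hd hz f)

theorem Sectorial.sectorExp_add (hR : Sectorial K R) (hd : DenseRange R) {z : ℂ}
    (hz : z ∈ polarSector K) (f g : H) :
    sectorExp R z (f + g) = sectorExp R z f + sectorExp R z g :=
  tendsto_nhds_unique (hR.tendsto_regExp hd hz (f + g)) <| by
    simpa using (hR.tendsto_regExp hd hz f).add (hR.tendsto_regExp hd hz g)

theorem Sectorial.sectorExp_smul (hR : Sectorial K R) (hd : DenseRange R) {z : ℂ}
    (hz : z ∈ polarSector K) (c : ℂ) (f : H) :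
    sectorExp R z (c • f) = c • sectorExp R z f :=
  tendsto_nhds_unique (hR.tendsto_regExp hd hz (c • f)) <| by
    simpa using (hR.tendsto_regExp hd hz f).const_smul c

theorem Sectorial.sectorExp_zero (hR : Sectorial K R) (hd : DenseRange R) (f : H) :
    sectorExp R 0 f = f :=
  tendsto_nhds_unique (hR.tendsto_regExp hd (zero_mem_polarSector K) f) <| by simp [regExp]

theorem Sectorial.sectorExp_add_left (hR : Sectorial K R) (hd : DenseRange R) {z w : ℂ}
    (hz : z ∈ polarSector K) (hw : w ∈ polarSector K) (f : H) :
    sectorExp R (z + w) f = sectorExp R z (sectorExp R w f) := by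
  refine tendsto_nhds_unique
    (hR.tendsto_regExp hd (add_mem_polarSector hR.1 hz hw) f) ?_
  have e : ∀ n, regExp R n (z + w) = regExp R n z * regExp R n w := fun n => by
    let _ : NormedAlgebra ℚ (H →L[ℂ] H) := NormedAlgebra.restrictScalars ℚ ℂ _
    rw [regExp, add_smul, NormedSpace.exp_add_of_commute]
    · rfl
    · exact ((Commute.refl _).smul_left z).smul_right w
  simp only [e]
  exact hR.tendsto_regExp_apply hd hz (hR.tendsto_regExp hd hw f)

theorem Sectorial.apply_sectorExp (hR : Sectorial K R) (hd : DenseRange R) {z : ℂ}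
    (hz : z ∈ polarSector K) (f : H) : R (sectorExp R z f) = sectorExp R z (R f) := by
  refine tendsto_nhds_unique ((R.continuous.tendsto _).comp (hR.tendsto_regExp hd hz f)) ?_
  have e : ∀ n, R (regExp R n z f) = regExp R n z (R f) := fun n =>
    congrArg (fun T : H →L[ℂ] H => T f)
      (((hR.commute_regInv (Nat.one_div_pos_of_nat (n := n))).neg_right.smul_right z).exp_right).eq
  simpa only [Function.comp_def, e] using hR.tendsto_regExp hd hz (R f)

theorem Sectorial.hasDerivAt_sectorExp_apply (hR : Sectorial K R) (hd : DenseRange R) {z : ℂ}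
    (hz : z ∈ openPolarSector K) (h : H) :
    HasDerivAt (fun z => sectorExp R z (R h)) (-sectorExp R z h) z := by
  have hopen := isOpen_openPolarSector K
  have hz' := openPolarSector_subset K hz
  refine ((hR.differentiableOn_sectorExp hd (R h)).differentiableAt
    (hopen.mem_nhds hz)).hasDerivAt.congr_deriv ?_
  have h1 := (((hR.tendstoLocallyUniformlyOn_regExp hd (R h)).mono
    (openPolarSector_subset K)).deriv (Eventually.of_forall fun n z _ =>
      (hasDerivAt_regExp R n (R h) z).differentiableAt.differentiableWithinAt)
      hopen).tendsto_at hz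
  refine tendsto_nhds_unique h1 ?_
  have e : ∀ n : ℕ, deriv (fun z => regExp R n z (R h)) z = -regExp R n z
      (h - ((1 / ((n : ℝ) + 1) : ℝ) : ℂ) • regInv R (1 / ((n : ℝ) + 1)) h) := fun n => by
    rw [(hasDerivAt_regExp R n (R h) z).deriv,
      hR.regInv_apply (Nat.one_div_pos_of_nat (n := n)), map_neg]
  simp only [Function.comp_apply, e]
  exact (hR.tendsto_regExp_apply hd hz'
    (by simpa using (hR.tendsto_smul_regInv hd h).const_sub h)).neg

end Limit

/-! ### The smoothing semigroup -/

section SmoothSemigroup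

/-- `S` is the strongly continuous semigroup generated by `-R⁻¹`, where `R` is injective and
bounded. The semigroup is smoothing: it maps into the domain of `R⁻¹` for positive times, and `C t`
is the bounded operator `R⁻¹ S t`, so that `S' = -C` on `(0, ∞)`. -/
structure IsSmoothSemigroup {H : Type*} [NormedAddCommGroup H] [InnerProductSpace ℂ H]
    (R : H →L[ℂ] H) (S C : ℝ → H →L[ℂ] H) : Prop where
  zero : S 0 = ContinuousLinearMap.id ℂ H
  add : ∀ s t, 0 ≤ s → 0 ≤ t → ∀ f, S (s + t) f = S s (S t f)
  comm : ∀ t, 0 ≤ t → ∀ f, R (S t f) = S t (R f)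
  continuousOn : ∀ f, ContinuousOn (fun t => S t f) (Ici 0)
  derivWithin_zero : ∀ f, HasDerivWithinAt (fun t => S t (R f)) (-f) (Ici 0) 0
  apply_deriv : ∀ t, 0 < t → ∀ f, R (C t f) = S t f
  hasDerivAt : ∀ t, 0 < t → ∀ f, HasDerivAt (fun t => S t f) (-C t f) t
  continuousOn_deriv : ∀ f, ContinuousOn (fun t => C t f) (Ioi 0)

/-- Smoothing holds because the semigroup extends holomorphically to a sector around `(0, ∞)`: its
derivative there exists on all of `H`, not only on the range of `R`. -/
theorem Sectorial.exists_isSmoothSemigroup {H : Type*} [NormedAddCommGroup H]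
    [InnerProductSpace ℂ H] [CompleteSpace H] {K : ℝ} {R : H →L[ℂ] H}
    (hR : Sectorial K R) (hinj : Function.Injective R) (hd : DenseRange R) :
    ∃ S C : ℝ → H →L[ℂ] H, IsSmoothSemigroup R S C := by
  have hsec : ∀ {t : ℝ}, 0 ≤ t → (t : ℂ) ∈ polarSector K := ofReal_mem_polarSector K
  have hopen : ∀ {t : ℝ}, 0 < t → (t : ℂ) ∈ openPolarSector K := ofReal_mem_openPolarSector K
  have hS : ∀ t : ℝ, ∃ T : H →L[ℂ] H, 0 ≤ t → ∀ f, T f = sectorExp R t f := fun t => by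
    by_cases ht : 0 ≤ t
    · refine ⟨LinearMap.mkContinuous
        { toFun := sectorExp R t
          map_add' := hR.sectorExp_add hd (hsec ht)
          map_smul' := hR.sectorExp_smul hd (hsec ht) } 1 fun f => ?_, fun _ f => rfl⟩
      simpa using hR.norm_sectorExp_le hd (hsec ht) f
    · exact ⟨0, fun h => absurd h ht⟩
  choose S hS using hS
  have hdiff : ∀ {t : ℝ}, 0 < t → ∀ f, DifferentiableAt ℂ (fun z => sectorExp R z f) t :=
    fun ht f => (hR.differentiableOn_sectorExp hd f).differentiableAt
      ((isOpen_openPolarSector K).mem_nhds (hopen ht))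
  -- `R` intertwines the derivative of `z ↦ exp (-z R⁻¹) f` with the derivative along the range
  -- of `R`, which is known
  have hRD : ∀ {t : ℝ}, 0 < t → ∀ f,
      R (-deriv (fun z => sectorExp R z f) t) = sectorExp R t f := fun {t} ht f => by
    have h1 := R.hasFDerivAt.comp_hasDerivAt (t : ℂ) (hdiff ht f).hasDerivAt
    have h2 := hR.hasDerivAt_sectorExp_apply hd (hopen ht) f
    have h3 : R ∘ (fun z => sectorExp R z f) =ᶠ[𝓝 (t : ℂ)] fun z => sectorExp R z (R f) := by
      filter_upwards [(isOpen_openPolarSector K).mem_nhds (hopen ht)] with z hz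
      exact hR.apply_sectorExp hd (openPolarSector_subset K hz) f
    rw [map_neg, h1.unique (h2.congr_of_eventuallyEq h3), neg_neg]
  -- boundedness of `R⁻¹ S t` comes from the closed graph theorem
  have hC : ∀ t : ℝ, ∃ T : H →L[ℂ] H, 0 < t →
      ∀ f, T f = -deriv (fun z => sectorExp R z f) t := fun t => by
    by_cases ht : 0 < t
    · have hlin : ∀ {f g : H}, R g = sectorExp R t f →
          -deriv (fun z => sectorExp R z f) t = g := fun h => hinj ((hRD ht _).trans h.symm)
      let D : H →ₗ[ℂ] H :=
        { toFun := fun f => -deriv (fun z => sectorExp R z f) t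
          map_add' := fun f g => hlin <| by
            rw [map_add, hRD ht, hRD ht, hR.sectorExp_add hd (hsec ht.le)]
          map_smul' := fun c f => hlin <| by
            rw [map_smul, hRD ht, hR.sectorExp_smul hd (hsec ht.le), RingHom.id_apply] }
      have hgraph : IsClosed (D.graph : Set (H × H)) := by
        have e : (D.graph : Set (H × H)) = {q | R q.2 = S t q.1} := by
          ext q
          rw [SetLike.mem_coe, LinearMap.mem_graph_iff, mem_ofPred_eq, hS t ht.le]
          exact ⟨fun h => by rw [h]; exact hRD ht _, fun h => (hlin h).symm⟩
        rw [e]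
        exact isClosed_eq (R.continuous.comp continuous_snd) ((S t).continuous.comp continuous_fst)
      exact ⟨⟨D, D.continuous_of_isClosed_graph hgraph⟩, fun _ f => rfl⟩
    · exact ⟨0, fun h => absurd h ht⟩
  choose C hC using hC
  have hcont : ∀ f, ContinuousOn (fun t => S t f) (Ici 0) := fun f => by
    refine ContinuousOn.congr ?_ fun t ht => hS t ht f
    exact (hR.continuousOn_sectorExp hd f).comp Complex.continuous_ofReal.continuousOn
      fun t ht => hsec ht
  have hderiv : ∀ t, 0 < t → ∀ f, HasDerivAt (fun t => S t f) (-C t f) t := fun t ht f => by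
    rw [hC t ht f, neg_neg]
    have h1 := (hdiff ht f).hasDerivAt.scomp t (Complex.ofRealCLM.hasDerivAt (x := t))
    rw [Complex.ofRealCLM_apply, Complex.ofReal_one, one_smul] at h1
    refine h1.congr_of_eventuallyEq ?_
    filter_upwards [Ioi_mem_nhds ht] with s hs
    exact hS s (le_of_lt hs) f
  refine ⟨S, C, ?_, ?_, ?_, hcont, ?_, ?_, hderiv, ?_⟩
  · ext f
    rw [hS 0 le_rfl f, Complex.ofReal_zero, hR.sectorExp_zero hd f]
    rfl
  · intro s t hs ht f
    rw [hS _ (add_nonneg hs ht), hS s hs, hS t ht, Complex.ofReal_add,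
      hR.sectorExp_add_left hd (hsec hs) (hsec ht)]
  · intro t ht f
    rw [hS t ht, hS t ht, hR.apply_sectorExp hd (hsec ht)]
  · intro f
    have hderiv' : ∀ t, 0 < t → HasDerivAt (fun t => S t (R f)) (-S t f) t := fun t ht => by
      refine (hderiv t ht (R f)).congr_deriv (congrArg Neg.neg (hinj ?_))
      rw [hC t ht, hRD ht, ← hR.apply_sectorExp hd (hsec ht.le), hS t ht.le]
    have h0 : S 0 f = f := by
      rw [hS 0 le_rfl f, Complex.ofReal_zero, hR.sectorExp_zero hd f]
    refine hasDerivWithinAt_Ici_of_tendsto_deriv (s := Ioi 0)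
      (fun t ht => (hderiv' t ht).differentiableAt.differentiableWithinAt)
      ((hcont (R f) 0 self_mem_Ici).mono Ioi_subset_Ici_self) self_mem_nhdsWithin ?_
    have h1 : Tendsto (fun t => -S t f) (𝓝[>] 0) (𝓝 (-f)) := by
      have h2 := ((hcont f 0 self_mem_Ici).mono Ioi_subset_Ici_self).tendsto.neg
      rwa [h0] at h2
    refine h1.congr' ?_
    filter_upwards [self_mem_nhdsWithin] with t ht
    exact (hderiv' t ht).deriv.symm
  · intro t ht f
    rw [hC t ht, hRD ht, hS t ht.le]
  · intro f
    refine ContinuousOn.congr ?_ fun t ht => hC t ht f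
    exact (((hR.differentiableOn_sectorExp hd f).deriv
      (isOpen_openPolarSector K)).continuousOn.comp Complex.continuous_ofReal.continuousOn
      fun t ht => hopen ht).neg

variable {H : Type*} [NormedAddCommGroup H] [InnerProductSpace ℂ H] {R : H →L[ℂ] H}
  {S C : ℝ → H →L[ℂ] H}

theorem IsSmoothSemigroup.deriv_comm (h : IsSmoothSemigroup R S C) (hinj : Function.Injective R)
    {t : ℝ} (ht : 0 < t) (f : H) : C t (R f) = S t f :=
  hinj (by rw [h.apply_deriv t ht, h.comm t ht.le])

theorem IsSmoothSemigroup.semigroup_deriv (h : IsSmoothSemigroup R S C)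
    (hinj : Function.Injective R) {s t : ℝ} (hs : 0 ≤ s) (ht : 0 < t) (f : H) :
    S s (C t f) = C (s + t) f :=
  hinj (by rw [h.comm s hs, h.apply_deriv t ht, h.apply_deriv _ (by linarith),
    h.add s t hs ht.le])

/-- `C s ∘ C t = R⁻² S (s + t)` depends on `s + t` only. -/
theorem IsSmoothSemigroup.deriv_deriv (h : IsSmoothSemigroup R S C)
    (hinj : Function.Injective R) {s t s' t' : ℝ} (hs : 0 < s) (ht : 0 < t) (hs' : 0 < s')
    (ht' : 0 < t') (e : s + t = s' + t') (f : H) : C s (C t f) = C s' (C t' f) :=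
  hinj (by rw [h.apply_deriv s hs, h.apply_deriv s' hs', h.semigroup_deriv hinj hs.le ht,
    h.semigroup_deriv hinj hs'.le ht', e])

theorem IsSmoothSemigroup.hasDerivAt_deriv (h : IsSmoothSemigroup R S C)
    (hinj : Function.Injective R) {t : ℝ} (ht : 0 < t) (f : H) :
    HasDerivAt (fun t => C t f) (-C (t / 2) (C (t / 2) f)) t := by
  have h1 : HasDerivAt (fun r => S (r - t / 2) (C (t / 2) f)) (-C (t / 2) (C (t / 2) f)) t := by
    have h2 := h.hasDerivAt (t - t / 2) (by linarith) (C (t / 2) f)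
    rw [sub_half] at h2
    exact HasDerivAt.comp_sub_const t (t / 2) (by rwa [sub_half])
  refine h1.congr_of_eventuallyEq ?_
  filter_upwards [Ioi_mem_nhds (show t / 2 < t by linarith)] with r hr
  rw [h.semigroup_deriv hinj (sub_nonneg.2 (le_of_lt hr)) (half_pos ht), sub_add_cancel]

theorem IsSmoothSemigroup.continuousOn_deriv_deriv (h : IsSmoothSemigroup R S C)
    (hinj : Function.Injective R) (f : H) :
    ContinuousOn (fun t => C (t / 2) (C (t / 2) f)) (Ioi 0) := by
  intro t (ht : 0 < t)
  have h1 : ContinuousAt (fun r => C (r - t / 2) (C (t / 2) f)) t := by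
    have h2 := (h.continuousOn_deriv (C (t / 2) f)).continuousAt
      (Ioi_mem_nhds (show 0 < t - t / 2 by linarith))
    exact ContinuousAt.comp (f := fun r : ℝ => r - t / 2) h2 (by fun_prop)
  refine (h1.congr ?_).continuousWithinAt
  filter_upwards [Ioi_mem_nhds (show t / 2 < t by linarith)] with r (hr : t / 2 < r)
  exact h.deriv_deriv hinj (by linarith) (by linarith) (by linarith) (by linarith) (by ring) f

end SmoothSemigroup

/-! ### Forms, resolvents and generators -/

section FormResolvent

variable {V H : Type*} [NormedAddCommGroup V] [InnerProductSpace ℂ V] [CompleteSpace V]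
  [NormedAddCommGroup H] [InnerProductSpace ℂ H] [CompleteSpace H]

open ContinuousLinearMap

theorem exists_representing_operator (j : V →L[ℂ] H) (a : V →ₗ[ℂ] V →ₗ⋆[ℂ] ℂ)
    (hb : FormBounded a) (hc : FormCoercive j a) :
    ∃ (ω K : ℝ) (N : V →L[ℂ] V), IsUnit N ∧ Sectorial K N ∧
      ∀ u v, inner ℂ v (N u) = a u v + ω * inner ℂ (j v) (j u) := by
  obtain ⟨M, hM⟩ := hb
  obtain ⟨ω, η, hη, hc⟩ := hc
  -- `Q` is the adjoint of the operator that represents `a`, as `B` is linear in its second argument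
  let B : V →L⋆[ℂ] V →L[ℂ] ℂ := LinearMap.mkContinuous₂ a.flip M fun v u => by
    rw [LinearMap.flip_apply, mul_right_comm]
    exact hM u v
  let Q := InnerProductSpace.continuousLinearMapOfBilin B
  let N : V →L[ℂ] V := adjoint Q + (ω : ℂ) • (adjoint j ∘L j)
  have hN : ∀ u v, inner ℂ v (N u) = a u v + ω * inner ℂ (j v) (j u) := fun u v => by
    have h1 : inner ℂ v (adjoint Q u) = a u v := by
      rw [adjoint_inner_right, InnerProductSpace.continuousLinearMapOfBilin_apply]
      rfl
    have h2 : inner ℂ v (adjoint j (j u)) = inner ℂ (j v) (j u) := adjoint_inner_right _ _ _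
    rw [← h1, ← h2, ← inner_smul_right, ← inner_add_right]
    rfl
  have hj : ∀ u, (ω : ℂ) * inner ℂ (j u) (j u) = ((ω * ‖j u‖ ^ 2 : ℝ) : ℂ) := fun u => by
    rw [inner_self_eq_norm_sq_to_K]
    simp
  have hre : ∀ u, η * ‖u‖ ^ 2 ≤ (inner ℂ u (N u)).re := fun u => by
    rw [hN, hj, Complex.add_re, Complex.ofReal_re]
    exact hc u
  refine ⟨ω, |M| / η, N, isUnit_of_coercive N hη hre, ⟨by positivity, fun u => ?_⟩, hN⟩
  refine ⟨le_trans (by positivity) (hre u), ?_⟩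
  have h3 : |M| * ‖u‖ ^ 2 ≤ |M| / η * (inner ℂ u (N u)).re := by
    rw [div_mul_eq_mul_div, le_div_iff₀ hη, mul_assoc, mul_comm _ η]
    exact mul_le_mul_of_nonneg_left (hre u) (abs_nonneg M)
  refine le_trans ?_ h3
  have h4 := hM u u
  rw [hN, hj, Complex.add_im, Complex.ofReal_im, add_zero]
  refine (Complex.abs_im_le_norm _).trans (h4.trans ?_)
  rw [mul_assoc, ← sq]
  exact mul_le_mul_of_nonneg_right (le_abs_self M) (sq_nonneg _)

/-- The operator `j N⁻¹ j*` on `H`. For invertible `N` it maps `h` to `j u`, where `u` is the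
Lax–Milgram solution of `(v|N u) = (j v|h)` for all `v`. -/
noncomputable def formResolvent (j : V →L[ℂ] H) (N : V →L[ℂ] V) : H →L[ℂ] H :=
  j ∘L Ring.inverse N ∘L adjoint j

theorem apply_inverse_apply {V : Type*} [NormedAddCommGroup V] [InnerProductSpace ℂ V]
    {N : V →L[ℂ] V} (hN : IsUnit N) (v : V) :
    N (Ring.inverse N v) = v :=
  congrArg (fun T : V →L[ℂ] V => T v) (Ring.mul_inverse_cancel _ hN)

theorem inverse_apply_apply {V : Type*} [NormedAddCommGroup V] [InnerProductSpace ℂ V]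
    {N : V →L[ℂ] V} (hN : IsUnit N) (v : V) :
    Ring.inverse N (N v) = v :=
  congrArg (fun T : V →L[ℂ] V => T v) (Ring.inverse_mul_cancel _ hN)

theorem adjoint_inverse (N : V →L[ℂ] V) :
    adjoint (Ring.inverse N) = Ring.inverse (adjoint N) :=
  (Ring.inverse_star N).symm

theorem adjoint_formResolvent (j : V →L[ℂ] H) (N : V →L[ℂ] V) :
    adjoint (formResolvent j N) = formResolvent j (adjoint N) := by
  rw [formResolvent, formResolvent, adjoint_comp, adjoint_comp, adjoint_adjoint, adjoint_inverse]
  rfl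

theorem injective_formResolvent {j : V →L[ℂ] H} (hj : Function.Injective j) (hd : DenseRange j)
    {N : V →L[ℂ] V} (hN : IsUnit N) : Function.Injective (formResolvent j N) := by
  rw [injective_iff_map_eq_zero]
  intro f hf
  have h1 : Ring.inverse N (adjoint j f) = 0 := hj (by rw [map_zero]; exact hf)
  have h2 : adjoint j f = 0 := by rw [← apply_inverse_apply hN (adjoint j f), h1, map_zero]
  refine hd.eq_zero_of_inner_right (𝕜 := ℂ) fun v => ?_
  rw [← adjoint_inner_right, h2, inner_zero_right]

theorem denseRange_formResolvent {j : V →L[ℂ] H} (hj : Function.Injective j) (hd : DenseRange j)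
    {N : V →L[ℂ] V} (hN : IsUnit N) : DenseRange (formResolvent j N) := by
  have hN' : IsUnit (adjoint N) := hN.star
  have h1 := injective_formResolvent hj hd hN'
  rw [← adjoint_formResolvent] at h1
  have h2 : (LinearMap.range (formResolvent j N).toLinearMap)ᗮ = ⊥ := by
    rw [ContinuousLinearMap.orthogonal_range]
    exact LinearMap.ker_eq_bot.2 h1
  have h3 := Submodule.topologicalClosure_eq_top_iff.2 h2
  exact Submodule.dense_iff_topologicalClosure_eq_top.2 h3

theorem Sectorial.formResolvent {K : ℝ} {N : V →L[ℂ] V} (hN : Sectorial K N) (hu : IsUnit N)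
    (j : V →L[ℂ] H) : Sectorial K (formResolvent j N) := by
  refine ⟨hN.1, fun f => ?_⟩
  have h1 : inner ℂ f (HeatKernel.formResolvent j N f) =
      conj (inner ℂ (Ring.inverse N (adjoint j f)) (N (Ring.inverse N (adjoint j f)))) := by
    rw [inner_conj_symm, apply_inverse_apply hu, adjoint_inner_left]
    rfl
  rw [h1, Complex.conj_re, Complex.conj_im, abs_neg]
  exact hN.2 _

/-- If `N` represents the form shifted by `ω`, then `formResolvent j N = (ω - A)⁻¹` for the
operator `A` associated with the form. -/
theorem mem_formOperator_graph_iff {j : V →L[ℂ] H} (hj : Function.Injective j)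
    (hd : DenseRange j) {a : V →ₗ[ℂ] V →ₗ⋆[ℂ] ℂ} {ω : ℝ} {N : V →L[ℂ] V} (hu : IsUnit N)
    (hN : ∀ u v, inner ℂ v (N u) = a u v + ω * inner ℂ (j v) (j u)) (f g : H) :
    (f, g) ∈ (formOperator j a).graph ↔ formResolvent j N ((ω : ℂ) • f - g) = f := by
  have key : ∀ v : V, (∀ w, a v w = -inner ℂ (j w) g) ↔
      N v = adjoint j ((ω : ℂ) • j v - g) := fun v => by
    have h1 : ∀ w, a v w = -inner ℂ (j w) g ↔
        inner ℂ w (N v) = inner ℂ w (adjoint j ((ω : ℂ) • j v - g)) := fun w => by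
      rw [hN, adjoint_inner_right, inner_sub_right, inner_smul_right, sub_eq_neg_add,
        add_left_inj]
    simp only [h1]
    exact ⟨ext_inner_left ℂ, fun h _ => by rw [h]⟩
  rw [mem_formOperator_graph j hj hd]
  constructor
  · rintro ⟨v, rfl, hv⟩
    change j (Ring.inverse N (adjoint j _)) = _
    rw [← (key v).1 hv, inverse_apply_apply hu]
  · intro h
    refine ⟨Ring.inverse N (adjoint j ((ω : ℂ) • f - g)), h, (key _).2 ?_⟩
    rw [apply_inverse_apply hu]
    congr 3
    exact h.symm

end FormResolvent

section Generator

open ContinuousLinearMap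

variable {E : Type*} [NormedAddCommGroup E] [InnerProductSpace ℂ E]
  {ω : ℝ} {R : E →L[ℂ] E} {S C : ℝ → E →L[ℂ] E} {A : E →ₗ.[ℂ] E}

theorem isClosed_of_resolvent
    (hA : ∀ f g, (f, g) ∈ A.graph ↔ R ((ω : ℂ) • f - g) = f) : A.IsClosed := by
  have e : (A.graph : Set (E × E)) = {q | R ((ω : ℂ) • q.1 - q.2) = q.1} := by
    ext ⟨f, g⟩
    exact hA f g
  change IsClosed (A.graph : Set (E × E))
  rw [e]
  exact isClosed_eq (by fun_prop) continuous_fst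

theorem IsSmoothSemigroup.isSemigroupGeneratedBy (h : IsSmoothSemigroup R S C)
    (hA : ∀ f g, (f, g) ∈ A.graph ↔ R ((ω : ℂ) • f - g) = f) :
    IsSemigroupGeneratedBy A fun t => (Real.exp (ω * t) : ℂ) • S t := by
  have hexp : ∀ t : ℝ, HasDerivAt (fun t : ℝ => (Real.exp (ω * t) : ℂ))
      ((Real.exp (ω * t) * ω : ℝ) : ℂ) t := fun t =>
    HasDerivAt.ofReal_comp (((hasDerivAt_id t).const_mul ω).exp.congr_deriv (by simp))
  -- the right derivative at `0` along the range of `R`, i.e. along the domain of `A`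
  have hlim : ∀ k, Tendsto
      (fun t : ℝ => ((t : ℂ))⁻¹ • (((Real.exp (ω * t) : ℂ) • S t) (R k) - R k)) (𝓝[>] 0)
      (𝓝 ((ω : ℂ) • R k - k)) := fun k => by
    have h1 := (hexp 0).hasDerivWithinAt.smul (h.derivWithin_zero k)
    rw [hasDerivWithinAt_iff_tendsto_slope, Ici_sdiff_left] at h1
    convert h1 using 2 with t
    · simp [slope, h.zero, ← Complex.ofReal_inv]
    · simp [h.zero]
      abel
  refine ⟨?_, ?_, ?_, ?_⟩
  · simp [h.zero]
  · intro s t hs ht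
    ext f
    simp only [mul_add, Real.exp_add, Complex.ofReal_mul, smul_apply, comp_apply, map_smul,
      h.add s t hs ht]
    rw [mul_comm, mul_smul]
  · intro f
    have h1 : ContinuousWithinAt (fun t => (Real.exp (ω * t) : ℂ) • S t f) (Ici 0) 0 :=
      (hexp 0).continuousAt.continuousWithinAt.smul (h.continuousOn f 0 self_mem_Ici)
    have h2 := (h1.mono Ioi_subset_Ici_self).tendsto
    simpa [h.zero] using h2
  · intro f g
    rw [hA]
    constructor
    · intro hf
      have h1 := hlim ((ω : ℂ) • f - g)
      rwa [hf, sub_sub_cancel] at h1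
    · -- applying `R` to the difference quotient gives the one along the range of `R`
      intro hg
      have h1 := (R.continuous.tendsto _).comp hg
      have h2 : (R ∘ fun t : ℝ => ((t : ℂ))⁻¹ • (((Real.exp (ω * t) : ℂ) • S t) f - f)) =ᶠ[𝓝[>] 0]
          fun t : ℝ => ((t : ℂ))⁻¹ • (((Real.exp (ω * t) : ℂ) • S t) (R f) - R f) := by
        filter_upwards [self_mem_nhdsWithin] with t (ht : 0 < t)
        simp [h.comm t ht.le]
      have h3 := tendsto_nhds_unique (h1.congr' h2) (hlim f)
      rw [map_sub, map_smul, h3, sub_sub_cancel]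

end Generator

/-! ### Kernels built from point evaluations -/

section EvaluationKernel

variable {X V : Type*} [NormedAddCommGroup V] [InnerProductSpace ℂ V]

/-- At finite distance the Hölder bound holds with the seminorm as the constant. At infinite
distance it may fail, as `0 * ∞ = 0`. -/
theorem edist_le_eHolderNorm_mul {E : Type*} [PseudoEMetricSpace X] [PseudoEMetricSpace E]
    {α : ℝ≥0} {f : X → E} (hf : eHolderNorm α f ≠ ∞) {x y : X}
    (hxy : edist x y ^ (α : ℝ) ≠ ∞) :
    edist (f x) (f y) ≤ eHolderNorm α f * edist x y ^ (α : ℝ) := by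
  rcases eq_or_ne (edist x y ^ (α : ℝ)) 0 with h0 | h0
  · obtain ⟨C, hC⟩ := eHolderNorm_ne_top.1 hf
    simpa [h0] using hC x y
  · rw [← ENNReal.div_le_iff h0 hxy]
    exact le_iInf₂ fun C hC => (ENNReal.div_le_iff h0 hxy).2 (hC x y)

/-- The point evaluations of a Hilbert space `V` continuously embedded in `C^{0,α}(X)` are
represented by vectors `d x ∈ V`; the map `d` is bounded and `α`-Hölder continuous. -/
theorem exists_evaluation_vectors [CompleteSpace V] [PseudoEMetricSpace X] {α : ℝ≥0}
    (ι : V →ₗ[ℂ] (X → ℂ))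
    {C : ℝ≥0} (hι : ∀ v, holderENorm α (ι v) ≤ C * ‖v‖ₑ) :
    ∃ d : X → V, (∀ x v, inner ℂ (d x) v = ι v x) ∧ (∀ x, ‖d x‖ₑ ≤ C) ∧ HolderWith C α d := by
  have hsup : ∀ v x, ‖ι v x‖ₑ ≤ C * ‖v‖ₑ := fun v x =>
    (le_iSup (fun x => ‖ι v x‖ₑ) x).trans (le_self_add.trans (hι v))
  have hhol : ∀ v x y, edist x y ^ (α : ℝ) ≠ ∞ →
      edist (ι v x) (ι v y) ≤ C * ‖v‖ₑ * edist x y ^ (α : ℝ) := fun v x y hxy => by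
    have h1 : eHolderNorm α (ι v) ≤ C * ‖v‖ₑ := le_add_self.trans (hι v)
    have h2 : eHolderNorm α (ι v) ≠ ∞ :=
      (h1.trans_lt (ENNReal.mul_lt_top ENNReal.coe_lt_top enorm_lt_top)).ne
    exact (edist_le_eHolderNorm_mul h2 hxy).trans (by gcongr)
  have hd : ∀ x, ∃ e : V, ∀ v, inner ℂ e v = ι v x := fun x => by
    let L : V →L[ℂ] ℂ := LinearMap.mkContinuous ((LinearMap.proj x).comp ι) C fun v => by
      have := hsup v x
      rw [← ofReal_norm, ← ofReal_norm, ← ENNReal.ofReal_coe_nnreal,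
        ← ENNReal.ofReal_mul C.coe_nonneg, ENNReal.ofReal_le_ofReal_iff (by positivity)] at this
      exact this
    exact ⟨(InnerProductSpace.toDual ℂ V).symm L, fun v =>
      InnerProductSpace.toDual_symm_apply⟩
  choose d hd using hd
  -- test the functional represented by `w` on `w` itself
  have hself : ∀ (w : V) (c : ℝ≥0∞), ‖inner ℂ w w‖ₑ ≤ c * ‖w‖ₑ → ‖w‖ₑ ≤ c := fun w c h => by
    rcases eq_or_ne w 0 with rfl | hw
    · simp
    · have h1 : ‖inner ℂ w w‖ₑ = ‖w‖ₑ * ‖w‖ₑ := by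
        rw [← ofReal_norm, ← ofReal_norm, ← ENNReal.ofReal_mul (norm_nonneg w), ← sq,
          ← inner_self_eq_norm_sq (𝕜 := ℂ), ← inner_self_re_eq_norm]
      rw [h1] at h
      exact (ENNReal.mul_le_mul_iff_left (enorm_ne_zero.2 hw) enorm_ne_top).1 h
  have hbd : ∀ x, ‖d x‖ₑ ≤ C := fun x => hself _ _ (by rw [hd]; exact hsup _ _)
  refine ⟨d, hd, hbd, fun x y => ?_⟩
  rw [edist_eq_enorm_sub]
  rcases eq_or_ne (edist x y ^ (α : ℝ)) ∞ with hxy | hxy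
  · rcases eq_or_ne C 0 with hC | hC
    · have hd0 : ∀ x, d x = 0 := fun x => by simpa [hC] using hbd x
      simp [hd0]
    · rw [hxy, ENNReal.mul_top (by simpa using hC)]
      exact le_top
  · refine hself _ _ ?_
    rw [inner_sub_left, hd, hd, ← edist_eq_enorm_sub, mul_right_comm]
    exact hhol _ x y hxy

/-- The function `(x, y) ↦ (d x | Q d y)`. When `d x` represents the evaluation at `x`, it is the
value at `x` of the function `Q (d y) ∈ V`. -/
noncomputable def evalKernel (d : X → V) (Q : V →L[ℂ] V) (x y : X) : ℂ := inner ℂ (d x) (Q (d y))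

theorem holderWith_evalKernel [PseudoEMetricSpace X] {α : ℝ≥0} {C : ℝ≥0} {d : X → V}
    (hb : ∀ x, ‖d x‖ₑ ≤ C) (hd : HolderWith C α d) (Q : V →L[ℂ] V) :
    HolderWith (2 * (C * ‖Q‖₊ * C)) α (onSumMetric (evalKernel d Q)) := by
  intro z w
  have hin : ∀ u v : V, ‖inner ℂ u (Q v)‖ₑ ≤ ‖u‖ₑ * ‖Q‖ₑ * ‖v‖ₑ := fun u v => by
    have h1 : ‖inner ℂ u (Q v)‖ ≤ ‖u‖ * ‖Q‖ * ‖v‖ := by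
      rw [mul_assoc]
      exact (norm_inner_le_norm _ _).trans (by gcongr; exact Q.le_opNorm v)
    rw [← ofReal_norm, ← ofReal_norm, ← ofReal_norm, ← ofReal_norm,
      ← ENNReal.ofReal_mul (by positivity), ← ENNReal.ofReal_mul (by positivity)]
    exact ENNReal.ofReal_le_ofReal h1
  have hz : ∀ x x' : X, ‖d x - d x'‖ₑ ≤ C * edist x x' ^ (α : ℝ) := fun x x' => by
    rw [← edist_eq_enorm_sub]
    exact hd x x'
  have e : onSumMetric (evalKernel d Q) z - onSumMetric (evalKernel d Q) w =
      inner ℂ (d z.fst - d w.fst) (Q (d z.snd)) + inner ℂ (d w.fst) (Q (d z.snd - d w.snd)) := by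
    simp only [onSumMetric, evalKernel, map_sub, inner_sub_left, inner_sub_right]
    ring
  have h1 : edist z.fst w.fst ^ (α : ℝ) ≤ edist z w ^ (α : ℝ) := by
    rw [edist_sumMetric z w]
    exact ENNReal.rpow_le_rpow le_self_add α.coe_nonneg
  have h2 : edist z.snd w.snd ^ (α : ℝ) ≤ edist z w ^ (α : ℝ) := by
    rw [edist_sumMetric z w]
    exact ENNReal.rpow_le_rpow le_add_self α.coe_nonneg
  rw [edist_eq_enorm_sub, e]
  calc _ ≤ _ := enorm_add_le _ _
    _ ≤ ‖d z.fst - d w.fst‖ₑ * ‖Q‖ₑ * ‖d z.snd‖ₑ +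
        ‖d w.fst‖ₑ * ‖Q‖ₑ * ‖d z.snd - d w.snd‖ₑ := add_le_add (hin _ _) (hin _ _)
    _ ≤ C * edist z w ^ (α : ℝ) * ‖Q‖ₑ * C + C * ‖Q‖ₑ * (C * edist z w ^ (α : ℝ)) := by
        gcongr
        · exact (hz _ _).trans (by gcongr)
        · exact hb _
        · exact hb _
        · exact (hz _ _).trans (by gcongr)
    _ = _ := by
        rw [enorm_eq_nnnorm]
        push_cast
        ring

theorem holderENorm_evalKernel_lt_top [PseudoEMetricSpace X] {α : ℝ≥0} {C : ℝ≥0} {d : X → V}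
    (hb : ∀ x, ‖d x‖ₑ ≤ C) (hd : HolderWith C α d) (Q : V →L[ℂ] V) :
    holderENorm α (onSumMetric (evalKernel d Q)) < ∞ := by
  refine ENNReal.add_lt_top.2 ⟨?_, ?_⟩
  · refine lt_of_le_of_lt (iSup_le fun z => ?_) (ENNReal.coe_lt_top (r := C * (‖Q‖₊ * C)))
    have h1 : ∀ x, ‖d x‖ ≤ C := fun x => by
      have := hb x
      rw [enorm_eq_nnnorm, ENNReal.coe_le_coe] at this
      exact this
    have h2 : ‖onSumMetric (evalKernel d Q) z‖₊ ≤ C * (‖Q‖₊ * C) := by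
      refine (norm_inner_le_norm _ _ : ‖inner ℂ (d z.fst) (Q (d z.snd))‖ ≤ _).trans ?_
      exact mul_le_mul (h1 _)
        ((Q.le_opNorm _).trans (mul_le_mul_of_nonneg_left (h1 _) (norm_nonneg Q)))
        (norm_nonneg _) C.coe_nonneg
    rw [enorm_eq_nnnorm]
    exact_mod_cast h2
  · exact (holderWith_evalKernel hb hd Q).eHolderNorm_le.trans_lt ENNReal.coe_lt_top

variable [MeasurableSpace X]

/-- A Hilbert space of functions with uniformly bounded point evaluations, embedded in
`L⁰` of a `σ`-finite measure, is separable: by Bessel's inequality an orthonormal family satisfies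
`∑ |bᵢ x|² ≤ C²`, so that on a set of finite measure only countably many `bᵢ` do not vanish almost
everywhere. -/
theorem countable_of_orthonormal_of_evaluation (μ : Measure X) [SigmaFinite μ]
    {d : X → V} {C : ℝ≥0} (hb : ∀ x, ‖d x‖ₑ ≤ C)
    (hm : ∀ v, Measurable fun x => inner ℂ (d x) v)
    (h0 : ∀ v, (∀ᵐ x ∂μ, inner ℂ (d x) v = 0) → v = 0)
    {I : Type*} {b : I → V} (hortho : Orthonormal ℂ b) : Countable I := by
  have hmeas : ∀ i, Measurable fun x => ‖inner ℂ (d x) (b i)‖ₑ ^ 2 := fun i =>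
    (hm (b i)).enorm.pow_const 2
  have hcount : ∀ n, (Function.support fun i =>
      ∫⁻ x in spanningSets μ n, ‖inner ℂ (d x) (b i)‖ₑ ^ 2 ∂μ).Countable := fun n => by
    refine Summable.countable_support_ennreal (ne_of_lt ?_)
    refine lt_of_le_of_lt ?_ (ENNReal.mul_lt_top (ENNReal.pow_lt_top (n := 2)
      (ENNReal.coe_lt_top (r := C))) (measure_spanningSets_lt_top μ n))
    rw [ENNReal.tsum_eq_iSup_sum]
    refine iSup_le fun s => ?_
    rw [← lintegral_finsetSum _ fun i _ => hmeas i, ← setLIntegral_const]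
    refine lintegral_mono fun x => ?_
    have h1 := hortho.sum_inner_products_le (d x) (s := s)
    have h2 : ∀ i, ‖inner ℂ (d x) (b i)‖ₑ ^ 2 = ENNReal.ofReal (‖inner ℂ (b i) (d x)‖ ^ 2) :=
      fun i => by rw [ENNReal.ofReal_pow (norm_nonneg _), norm_inner_symm, ofReal_norm]
    calc ∑ i ∈ s, ‖inner ℂ (d x) (b i)‖ₑ ^ 2
        = ENNReal.ofReal (∑ i ∈ s, ‖inner ℂ (b i) (d x)‖ ^ 2) := by
          rw [ENNReal.ofReal_sum_of_nonneg fun i _ => by positivity]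
          exact Finset.sum_congr rfl fun i _ => h2 i
      _ ≤ ENNReal.ofReal (‖d x‖ ^ 2) := ENNReal.ofReal_le_ofReal h1
      _ = ‖d x‖ₑ ^ 2 := by rw [ENNReal.ofReal_pow (norm_nonneg _), ofReal_norm]
      _ ≤ (C : ℝ≥0∞) ^ 2 := by gcongr; exact hb x
  have huniv : (⋃ n, Function.support fun i =>
      ∫⁻ x in spanningSets μ n, ‖inner ℂ (d x) (b i)‖ₑ ^ 2 ∂μ) = (univ : Set I) := by
    refine eq_univ_of_forall fun i => ?_
    by_contra hi
    simp only [mem_iUnion, not_exists, Function.mem_support, not_not] at hi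
    refine hortho.ne_zero i (h0 _ ?_)
    rw [← Measure.restrict_univ (μ := μ), ← iUnion_spanningSets μ, ae_restrict_iUnion_iff]
    intro n
    have h1 := (lintegral_eq_zero_iff (hmeas i)).1 (hi n)
    filter_upwards [h1] with x hx
    simpa using hx
  exact countable_univ_iff.1 (huniv ▸ countable_iUnion hcount)

theorem measurable_evalKernel [CompleteSpace V] (μ : Measure X) [SigmaFinite μ]
    {d : X → V} {C : ℝ≥0} (hb : ∀ x, ‖d x‖ₑ ≤ C)
    (hm : ∀ v, Measurable fun x => inner ℂ (d x) v)
    (h0 : ∀ v, (∀ᵐ x ∂μ, inner ℂ (d x) v = 0) → v = 0) (Q : V →L[ℂ] V) :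
    Measurable fun z : X × X => evalKernel d Q z.1 z.2 := by
  obtain ⟨w, b, -⟩ := exists_hilbertBasis ℂ V
  have : Countable w := countable_of_orthonormal_of_evaluation μ hb hm h0 b.orthonormal
  have hm' : ∀ v, Measurable fun x => inner ℂ v (d x) := fun v => by
    have : (fun x => inner ℂ v (d x)) = fun x => conj (inner ℂ (d x) v) :=
      funext fun x => (inner_conj_symm _ _).symm
    rw [this]
    exact Complex.continuous_conj.measurable.comp (hm v)
  refine measurable_of_tendsto_metrizable' atTop
    (f := fun (s : Finset w) (z : X × X) =>
      ∑ i ∈ s, inner ℂ (d z.1) (b i) * inner ℂ (Q.adjoint (b i)) (d z.2)) (fun s => ?_) ?_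
  · exact Finset.measurable_sum s fun i _ =>
      ((hm (b i)).comp measurable_fst).mul ((hm' _).comp measurable_snd)
  · rw [tendsto_pi_nhds]
    intro z
    simp only [ContinuousLinearMap.adjoint_inner_left]
    exact b.hasSum_inner_mul_inner (d z.1) (Q (d z.2))

end EvaluationKernel

/-! ### Resolvent kernels and the heat kernel -/

section ResolventKernel

open ContinuousLinearMap

theorem inner_star_star {X : Type*} [MeasurableSpace X] {μ : Measure X} (f g : Lp ℂ 2 μ) :
    inner ℂ (star f) (star g) = conj (inner ℂ f g) := by
  rw [L2.inner_def, L2.inner_def, ← integral_conj]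
  refine integral_congr_ae ?_
  filter_upwards [Lp.coeFn_star f, Lp.coeFn_star g] with x hf hg
  rw [hf, hg]
  simp

theorem integral_star_mul {X : Type*} [MeasurableSpace X] {μ : Measure X} {k : X → ℂ}
    {g : Lp ℂ 2 μ} (hk : ((star g : Lp ℂ 2 μ) : X → ℂ) =ᵐ[μ] k) (f : Lp ℂ 2 μ) :
    ∫ y, k y * f y ∂μ = inner ℂ g f := by
  rw [L2.inner_def]
  refine integral_congr_ae ?_
  filter_upwards [hk, Lp.coeFn_star g] with y h1 h2
  rw [← h1, h2]
  simp [mul_comm]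

variable {X V : Type*} [MeasurableSpace X] {μ : Measure X}
  [NormedAddCommGroup V] [InnerProductSpace ℂ V] [CompleteSpace V]

/-- The integral kernel of the operator `R B R` on `L²`, where `R = formResolvent j N`. It is
defined at every point, because `R` factors through `V`. -/
noncomputable def resolventKernel (j : V →L[ℂ] Lp ℂ 2 μ) (N : V →L[ℂ] V) (d : X → V)
    (B : Lp ℂ 2 μ →L[ℂ] Lp ℂ 2 μ) : X → X → ℂ :=
  evalKernel d (Ring.inverse N ∘L adjoint j ∘L B ∘L j ∘L Ring.inverse N)

variable {j : V →L[ℂ] Lp ℂ 2 μ} {N : V →L[ℂ] V} {d : X → V}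

/-- As a function of `x`, the kernel is the image of an element of `L²` under `R`. -/
theorem resolventKernel_left
    (hjd : ∀ v, j v =ᵐ[μ] fun x => inner ℂ (d x) v) (B : Lp ℂ 2 μ →L[ℂ] Lp ℂ 2 μ) (y : X) :
    formResolvent j N (B (j (Ring.inverse N (d y)))) =ᵐ[μ]
      fun x => resolventKernel j N d B x y :=
  hjd _

/-- As a function of `y`, the kernel is the conjugate of an element of the range of `R*`. -/
theorem resolventKernel_right
    (hjd : ∀ v, j v =ᵐ[μ] fun x => inner ℂ (d x) v) (B : Lp ℂ 2 μ →L[ℂ] Lp ℂ 2 μ) (x : X) :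
    ((star (adjoint (formResolvent j N) (adjoint B (j (adjoint (Ring.inverse N) (d x))))) :
      Lp ℂ 2 μ) : X → ℂ) =ᵐ[μ]
      fun y => resolventKernel j N d B x y := by
  rw [adjoint_formResolvent]
  filter_upwards [Lp.coeFn_star (formResolvent j (adjoint N)
    (adjoint B (j (adjoint (Ring.inverse N) (d x))))), hjd (Ring.inverse (adjoint N)
      (adjoint j (adjoint B (j (adjoint (Ring.inverse N) (d x))))))] with y h1 h2
  rw [h1, Pi.star_apply]
  refine (congrArg star h2).trans ?_
  rw [← adjoint_inverse, ← starRingEnd_apply, inner_conj_symm, adjoint_inner_left,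
    adjoint_inner_left, adjoint_inner_left, ← adjoint_inner_right j, adjoint_inner_left]
  rfl

theorem integrable_resolventKernel_mul
    (hjd : ∀ v, j v =ᵐ[μ] fun x => inner ℂ (d x) v)
    (B : Lp ℂ 2 μ →L[ℂ] Lp ℂ 2 μ) (x : X) (f : Lp ℂ 2 μ) :
    Integrable (fun y => resolventKernel j N d B x y * f y) μ :=
  MemLp.integrable_mul (p := 2) (q := 2)
    ((memLp_congr_ae (resolventKernel_right hjd B x)).1 (Lp.memLp _)) (Lp.memLp f)

theorem integral_resolventKernel_mul
    (hjd : ∀ v, j v =ᵐ[μ] fun x => inner ℂ (d x) v)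
    (B : Lp ℂ 2 μ →L[ℂ] Lp ℂ 2 μ) (x : X) (f : Lp ℂ 2 μ) :
    ∫ y, resolventKernel j N d B x y * f y ∂μ =
      inner ℂ (d x) (Ring.inverse N (adjoint j (B (formResolvent j N f)))) := by
  rw [integral_star_mul (resolventKernel_right hjd B x), adjoint_inner_left, adjoint_inner_left,
    ← adjoint_inner_right j, adjoint_inner_left]

/-- `resolventKernel j N d B` is indeed the integral kernel of `R B R`. -/
theorem integral_resolventKernel_mul_ae
    (hjd : ∀ v, j v =ᵐ[μ] fun x => inner ℂ (d x) v)
    (B : Lp ℂ 2 μ →L[ℂ] Lp ℂ 2 μ) (f : Lp ℂ 2 μ) :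
    formResolvent j N (B (formResolvent j N f)) =ᵐ[μ]
      fun x => ∫ y, resolventKernel j N d B x y * f y ∂μ := by
  simp only [integral_resolventKernel_mul hjd]
  exact hjd _

/-- Composition of kernels, at every point. -/
theorem integral_resolventKernel_mul_resolventKernel
    (hjd : ∀ v, j v =ᵐ[μ] fun x => inner ℂ (d x) v) (B B' : Lp ℂ 2 μ →L[ℂ] Lp ℂ 2 μ)
    (x y : X) :
    ∫ w, resolventKernel j N d B x w * resolventKernel j N d B' w y ∂μ =
      resolventKernel j N d (B ∘L formResolvent j N ∘L formResolvent j N ∘L B') x y := by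
  rw [integral_congr_ae (g := fun w => resolventKernel j N d B x w *
    formResolvent j N (B' (j (Ring.inverse N (d y)))) w), integral_resolventKernel_mul hjd]
  · rfl
  · filter_upwards [resolventKernel_left hjd B' y] with w hw
    rw [hw]

end ResolventKernel

section HeatKernelOfSemigroup

open ContinuousLinearMap

variable {X V : Type*} [MeasurableSpace X] {μ : Measure X}
  [NormedAddCommGroup V] [InnerProductSpace ℂ V] [CompleteSpace V]
  {j : V →L[ℂ] Lp ℂ 2 μ} {N : V →L[ℂ] V} {d : X → V}

/-- The heat kernel `p_t`: since `e^{tA} = e^{ωt} S t = R (e^{ωt} R⁻² S t) R`, it is the resolvent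
kernel of `e^{ωt} R⁻² S t = e^{ωt} C (t/2) C (t/2)`. -/
noncomputable def heatKernel (j : V →L[ℂ] Lp ℂ 2 μ) (N : V →L[ℂ] V) (d : X → V) (ω : ℝ)
    (C : ℝ → Lp ℂ 2 μ →L[ℂ] Lp ℂ 2 μ) (t : ℝ) : X → X → ℂ :=
  resolventKernel j N d ((Real.exp (ω * t) : ℂ) • (C (t / 2) ∘L C (t / 2)))

variable {ω : ℝ} {S C : ℝ → Lp ℂ 2 μ →L[ℂ] Lp ℂ 2 μ} {A : Lp ℂ 2 μ →ₗ.[ℂ] Lp ℂ 2 μ}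

theorem isKernelOf_heatKernel (hjd : ∀ v, j v =ᵐ[μ] fun x => inner ℂ (d x) v)
    (h : IsSmoothSemigroup (formResolvent j N) S C)
    (hinj : Function.Injective (formResolvent j N)) :
    IsKernelOf (fun t => (Real.exp (ω * t) : ℂ) • S t) (heatKernel j N d ω C) := by
  intro t ht f
  have h1 := integral_resolventKernel_mul_ae (N := N) hjd
    ((Real.exp (ω * t) : ℂ) • (C (t / 2) ∘L C (t / 2))) f
  have e : formResolvent j N (((Real.exp (ω * t) : ℂ) • (C (t / 2) ∘L C (t / 2)))
      (formResolvent j N f)) = ((Real.exp (ω * t) : ℂ) • S t) f := by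
    have ht2 := half_pos ht
    rw [smul_apply, comp_apply, map_smul, h.apply_deriv _ ht2, h.deriv_comm hinj ht2,
      ← h.add _ _ ht2.le ht2.le, add_halves]
    rfl
  rwa [e] at h1

theorem isHeatKernel_heatKernel (hjd : ∀ v, j v =ᵐ[μ] fun x => inner ℂ (d x) v)
    (hm : ∀ t, 0 < t → Measurable fun z : X × X => heatKernel j N d ω C t z.1 z.2)
    (h : IsSmoothSemigroup (formResolvent j N) S C)
    (hinj : Function.Injective (formResolvent j N))
    (hA : ∀ f g, (f, g) ∈ A.graph ↔ formResolvent j N ((ω : ℂ) • f - g) = f) :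
    IsHeatKernel A (heatKernel j N d ω C) := by
  have hexp : ∀ t : ℝ, HasDerivAt (fun t : ℝ => (Real.exp (ω * t) : ℂ))
      (ω * (Real.exp (ω * t) : ℂ)) t := fun t => by
    have h1 := HasDerivAt.ofReal_comp ((hasDerivAt_id t).const_mul ω).exp
    refine h1.congr_deriv ?_
    simp [mul_comm]
  have hcont : ContinuousOn (fun t : ℝ => (Real.exp (ω * t) : ℂ)) (Ioi 0) := fun t _ =>
    (hexp t).continuousAt.continuousWithinAt
  have hRE : ∀ t, 0 < t → ∀ f, formResolvent j N (C (t / 2) (C (t / 2) f)) = C t f :=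
    fun t ht f => by
      rw [h.apply_deriv _ (half_pos ht), h.semigroup_deriv hinj (half_pos ht).le (half_pos ht),
        add_halves]
  refine ⟨isClosed_of_resolvent hA, hm,
    fun t _ f => ae_of_all _ fun x => integrable_resolventKernel_mul hjd _ x f,
    fun t ht f => (memLp_congr_ae (isKernelOf_heatKernel (ω := ω) hjd h hinj t ht f)).1
      (Lp.memLp _), ae_of_all _ fun y => ?_, ?_⟩
  · set ψ := j (Ring.inverse N (d y))
    refine ⟨fun t => (Real.exp (ω * t) : ℂ) • C t ψ,
      fun t => (ω : ℂ) • (Real.exp (ω * t) : ℂ) • C t ψ -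
        (Real.exp (ω * t) : ℂ) • C (t / 2) (C (t / 2) ψ), ?_, ?_, ?_, ?_, ?_⟩
    · intro t ht
      have h1 := resolventKernel_left (N := N) hjd
        ((Real.exp (ω * t) : ℂ) • (C (t / 2) ∘L C (t / 2))) y
      rw [smul_apply, comp_apply, map_smul, hRE t ht] at h1
      exact h1
    · intro t ht
      rw [hA, sub_sub_cancel, map_smul, hRE t ht]
    · intro t ht
      refine ((hexp t).smul (h.hasDerivAt_deriv hinj ht ψ)).congr_deriv ?_
      rw [smul_neg, mul_smul]
      exact neg_add_eq_sub _ _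
    · exact hcont.smul (h.continuousOn_deriv ψ)
    · exact ((hcont.smul (h.continuousOn_deriv ψ)).const_smul (ω : ℂ)).sub
        (hcont.smul (h.continuousOn_deriv_deriv hinj ψ))
  · intro s t hs ht
    refine ae_of_all _ fun z => ?_
    rw [heatKernel, heatKernel, heatKernel, integral_resolventKernel_mul_resolventKernel hjd]
    congr 2
    ext1 f
    have ht2 := half_pos ht
    have hs2 := half_pos hs
    simp only [smul_apply, comp_apply, map_smul, smul_smul, ← Complex.ofReal_mul,
      ← Real.exp_add, ← mul_add]
    rw [add_comm t s]
    congr 1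
    rw [h.deriv_comm hinj ht2, ← h.comm _ ht2.le, h.deriv_comm hinj ht2,
      ← h.add _ _ ht2.le ht2.le, add_halves, h.semigroup_deriv hinj ht.le hs2]
    exact h.deriv_deriv hinj (by linarith) (by linarith) (by linarith) (by linarith) (by ring) f

/-- The operators `F = R⁻³ S t` and `F' = R⁻⁴ S t`; recall `C (t/2) C (t/2) = R⁻² S t`. -/
theorem IsSmoothSemigroup.exists_iterated_deriv {H : Type*} [NormedAddCommGroup H]
    [InnerProductSpace ℂ H] {R : H →L[ℂ] H} {S C : ℝ → H →L[ℂ] H}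
    (h : IsSmoothSemigroup R S C) (hinj : Function.Injective R) {t : ℝ} (ht : 0 < t) :
    ∃ F F' : H →L[ℂ] H, (∀ f, R (F f) = C (t / 2) (C (t / 2) f)) ∧
      (∀ f, F (R f) = C (t / 2) (C (t / 2) f)) ∧ ∀ f, R (F' f) = F f := by
  have hc : ∀ s, 0 < s → ∀ f, C s (R f) = R (C s f) := fun s hs f => by
    rw [h.deriv_comm hinj hs, h.apply_deriv s hs]
  have ht2 : 0 < t / 2 := by linarith
  have ht4 : 0 < t / 4 := by linarith
  have hRF : ∀ f, R (C (t / 2) (C (t / 4) (C (t / 4) f))) = C (t / 2) (C (t / 2) f) := fun f => by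
    rw [h.apply_deriv _ ht2, h.semigroup_deriv hinj ht2.le ht4]
    exact h.deriv_deriv hinj (by linarith) ht4 ht2 ht2 (by ring) f
  refine ⟨C (t / 2) ∘L C (t / 4) ∘L C (t / 4),
    C (t / 4) ∘L C (t / 4) ∘L C (t / 4) ∘L C (t / 4), hRF, fun f => ?_, fun f => ?_⟩
  · rw [← hRF, comp_apply, comp_apply, hc _ ht4, hc _ ht4, hc _ ht2]
  · simp only [comp_apply]
    rw [h.apply_deriv _ ht4, h.semigroup_deriv hinj ht4.le ht4]
    congr 2
    ring

end HeatKernelOfSemigroup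

/-! ### Operators acting on one variable of the heat kernel -/

section Mixed

open ContinuousLinearMap

/-- The operator associated with a real form commutes with complex conjugation. -/
theorem star_mem_formOperator_graph {X V : Type*} [MeasurableSpace X] {μ : Measure X}
    [NormedAddCommGroup V] [InnerProductSpace ℂ V] {j : V →L[ℂ] Lp ℂ 2 μ}
    (hj : Function.Injective j) (hd : DenseRange j)
    (ι : V →ₗ[ℂ] (X → ℂ)) (hιj : ∀ v, j v =ᵐ[μ] ι v) {a : V →ₗ[ℂ] V →ₗ⋆[ℂ] ℂ}
    (ha : FormReal ι a) (f g : Lp ℂ 2 μ) (hfg : (f, g) ∈ (formOperator j a).graph) :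
    (star f, star g) ∈ (formOperator j a).graph := by
  rw [mem_formOperator_graph j hj hd] at hfg ⊢
  obtain ⟨v, rfl, hv⟩ := hfg
  have hstar : ∀ u u' : V, (∀ x, ι u' x = conj (ι u x)) → j u' = star (j u) := fun u u' hu => by
    refine Lp.ext ?_
    filter_upwards [hιj u, hιj u', Lp.coeFn_star (j u)] with x h1 h2 h3
    rw [h2, h3, hu, Pi.star_apply, h1]
    rfl
  obtain ⟨v', hv'⟩ := ha.1 v
  refine ⟨v', hstar v v' hv', fun w => ?_⟩
  obtain ⟨w', hw'⟩ := ha.1 w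
  have hw : ∀ x, ι w x = conj (ι w' x) := fun x => by rw [hw', Complex.conj_conj]
  rw [ha.2 v v' w' w hv' hw, hv, hstar w' w hw, inner_star_star, map_neg]

variable {X V : Type*} [MeasurableSpace X] {μ : Measure X}
  [NormedAddCommGroup V] [InnerProductSpace ℂ V] [CompleteSpace V]
  {j : V →L[ℂ] Lp ℂ 2 μ} {N : V →L[ℂ] V} {d : X → V}
  {ω : ℝ} {S C : ℝ → Lp ℂ 2 μ →L[ℂ] Lp ℂ 2 μ} {A : Lp ℂ 2 μ →ₗ.[ℂ] Lp ℂ 2 μ}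

/-- Both `A'_y p_t` and `A_x A'_y p_t` are again resolvent kernels. Indeed `p_t` is the kernel of
`R B R` with `B = e^{ωt} R⁻² S t`; moreover `A R = ω R - 1`, and `R A = ω R - 1` on the domain of
`A = ω - R⁻¹`. Hence applying `A'` in `y` turns `B` into `B' = ω B - R⁻¹ B`, and applying `A` in
`x` turns `B'` into `B'' = ω B' - R⁻¹ B'`. This needs no symmetry of the form. If `R` is
self-adjoint and `A` commutes with complex conjugation, then `A' = A` on the functions
`p_t (x, ·)`. -/
theorem mixedHolder_heatKernel [PseudoEMetricSpace X] {α : ℝ≥0}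
    (hjd : ∀ v, j v =ᵐ[μ] fun x => inner ℂ (d x) v)
    (hm : ∀ B, Measurable fun z : X × X => resolventKernel j N d B z.1 z.2)
    (hα : ∀ B, MemHolder α (onSumMetric (resolventKernel j N d B)))
    (h : IsSmoothSemigroup (formResolvent j N) S C)
    (hinj : Function.Injective (formResolvent j N))
    (hA : ∀ f g, (f, g) ∈ A.graph ↔ formResolvent j N ((ω : ℂ) • f - g) = f)
    {t : ℝ} (ht : 0 < t) :
    MixedHolder α A (dualGraph A) (heatKernel j N d ω C t) ∧
      (adjoint (formResolvent j N) = formResolvent j N →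
        (∀ f g : Lp ℂ 2 μ, (f, g) ∈ A.graph → (star f, star g) ∈ A.graph) →
        MixedHolder α A A.graph (heatKernel j N d ω C t)) := by
  obtain ⟨F, F', hRF, hFR, hRF'⟩ := h.exists_iterated_deriv hinj ht
  set R := formResolvent j N with hR
  set e : ℂ := (Real.exp (ω * t) : ℂ)
  set B : Lp ℂ 2 μ →L[ℂ] Lp ℂ 2 μ := e • (C (t / 2) ∘L C (t / 2)) with hB
  set B' : Lp ℂ 2 μ →L[ℂ] Lp ℂ 2 μ := (ω : ℂ) • B - e • F with hB'
  set B'' : Lp ℂ 2 μ →L[ℂ] Lp ℂ 2 μ := (ω : ℂ) • B' - e • ((ω : ℂ) • F - F') with hB''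
  have hBR : ∀ f, e • F (R f) = B f := fun f => by rw [hFR]; rfl
  have hRB : ∀ f, R (e • F f) = B f := fun f => by rw [map_smul, hRF]; rfl
  have hleft : ∀ y, ∃ f g : Lp ℂ 2 μ, f =ᵐ[μ] (fun x => resolventKernel j N d B' x y) ∧
      g =ᵐ[μ] (fun x => resolventKernel j N d B'' x y) ∧ (f, g) ∈ A.graph := fun y => by
    refine ⟨_, _, resolventKernel_left hjd B' y, resolventKernel_left hjd B'' y, (hA _ _).2 ?_⟩
    rw [← hR, ← map_smul, ← map_sub]
    congr 1
    set ψ := j (Ring.inverse N (d y))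
    have h1 : (ω : ℂ) • B' ψ - B'' ψ = (ω : ℂ) • (e • F ψ) - e • F' ψ := by
      simp only [hB'', sub_apply, smul_apply, sub_sub_cancel]
      rw [smul_sub, smul_comm]
    rw [h1, map_sub, map_smul, hRB, map_smul, hRF']
    rfl
  have hmixed : ∀ Gy : Set (Lp ℂ 2 μ × Lp ℂ 2 μ),
      (∀ x, ∃ f g : Lp ℂ 2 μ, f =ᵐ[μ] (fun y => resolventKernel j N d B x y) ∧
        g =ᵐ[μ] (fun y => resolventKernel j N d B' x y) ∧ (f, g) ∈ Gy) →
      MixedHolder α A Gy (heatKernel j N d ω C t) := fun Gy hGy =>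
    ⟨resolventKernel j N d B', resolventKernel j N d B'', hm B', hm B'', hGy, hleft, hα B''⟩
  refine ⟨hmixed _ fun x => ?_, fun hsa hconj => hmixed _ fun x => ?_⟩
  · refine ⟨_, _, resolventKernel_right hjd B x, resolventKernel_right hjd B' x,
      fun f g hfg => ?_⟩
    have h1 : ∀ (D : Lp ℂ 2 μ →L[ℂ] Lp ℂ 2 μ) (u : Lp ℂ 2 μ),
        ∫ y, u y * (star (adjoint R (adjoint D (j (adjoint (Ring.inverse N) (d x))))) :
          Lp ℂ 2 μ) y ∂μ = inner ℂ (j (adjoint (Ring.inverse N) (d x))) (D (R u)) := fun D u => by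
      rw [← adjoint_inner_left, ← adjoint_inner_left, ← integral_star_mul EventuallyEq.rfl]
      simp only [mul_comm]
    refine (h1 B g).trans (Eq.trans ?_ (h1 B' f).symm)
    congr 1
    have h2 : R g = (ω : ℂ) • R f - f := by
      have h3 := (hA f g).1 hfg
      rw [map_sub, map_smul] at h3
      exact (sub_eq_iff_eq_add'.2 (sub_eq_iff_eq_add.1 h3)).symm
    rw [h2, map_sub, map_smul, ← hBR f]
    rfl
  · refine ⟨_, _, resolventKernel_right hjd B x, resolventKernel_right hjd B' x,
      hconj _ _ ((hA _ _).2 ?_)⟩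
    rw [← hR, hsa]
    set φ := j (adjoint (Ring.inverse N) (d x))
    rw [← map_smul, ← map_sub]
    congr 1
    have h1 : B = (e • F) ∘L R := by ext1 f; exact (hBR f).symm
    have h2 : adjoint B' = (ω : ℂ) • adjoint B - adjoint (e • F) := by
      rw [hB', map_sub, map_smulₛₗ, Complex.conj_ofReal]
    have h3 : R (adjoint (e • F) φ) = adjoint B φ := by
      rw [h1, adjoint_comp, hsa]
      rfl
    rw [h2, sub_apply, smul_apply, sub_sub_cancel, h3]

/-- A symmetric form is represented by a self-adjoint operator. -/
theorem adjoint_eq_of_formSymmetric {H : Type*} [NormedAddCommGroup H] [InnerProductSpace ℂ H]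
    {j : V →L[ℂ] H} {a : V →ₗ[ℂ] V →ₗ⋆[ℂ] ℂ} (ha : FormSymmetric a)
    (hN : ∀ u v, inner ℂ v (N u) = a u v + ω * inner ℂ (j v) (j u)) : adjoint N = N := by
  refine ContinuousLinearMap.ext fun u => ext_inner_left ℂ fun v => ?_
  rw [adjoint_inner_right, ← inner_conj_symm, hN, hN, ha u v, map_add, map_mul,
    Complex.conj_ofReal, inner_conj_symm]

end Mixed

end HeatKernel

theorem mainTheorem3 {X : Type*} [EMetricSpace X] [MeasurableSpace X]
    (μ : Measure X) [SigmaFinite μ]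
    (α : ℝ≥0) (hα0 : 0 < α) (hα1 : α ≤ 1)
    {V : Type*} [NormedAddCommGroup V] [InnerProductSpace ℂ V] [CompleteSpace V]
    -- `V` is densely and continuously embedded in `L²(X)` by `j`
    (j : V →L[ℂ] Lp ℂ 2 μ) (hj : Function.Injective j) (hjd : DenseRange j)
    -- and continuously embedded in `C^{0,α}(X)` by `ι`, consistently with `j`
    (ι : V →ₗ[ℂ] (X → ℂ)) (hιm : ∀ v, Measurable (ι v))
    (hιj : ∀ v, j v =ᵐ[μ] ι v)
    (hι : ∃ C : ℝ≥0, ∀ v, HeatKernel.holderENorm α (ι v) ≤ C * ‖v‖ₑ)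
    (a : V →ₗ[ℂ] V →ₗ⋆[ℂ] ℂ)
    (ha_bdd : HeatKernel.FormBounded a) (ha_coer : HeatKernel.FormCoercive j a) :
    ∃ (T : ℝ → Lp ℂ 2 μ →L[ℂ] Lp ℂ 2 μ) (p : ℝ → X → X → ℂ),
      HeatKernel.IsSemigroupGeneratedBy (HeatKernel.formOperator j a) T ∧
      HeatKernel.IsHeatKernel (HeatKernel.formOperator j a) p ∧
      HeatKernel.IsKernelOf T p ∧
      (∀ t, 0 < t → HeatKernel.holderENorm α (HeatKernel.onSumMetric (p t)) < ∞) ∧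
      (HeatKernel.FormSymmetric a → ∀ t, 0 < t →
        HeatKernel.MixedHolder α (HeatKernel.formOperator j a)
          (HeatKernel.dualGraph (HeatKernel.formOperator j a)) (p t) ∧
        (HeatKernel.FormReal ι a →
          HeatKernel.MixedHolder α (HeatKernel.formOperator j a)
            (HeatKernel.formOperator j a).graph (p t))) := by
  obtain ⟨C, hι⟩ := hι
  obtain ⟨d, hd, hdb, hdα⟩ := HeatKernel.exists_evaluation_vectors ι hι
  obtain ⟨ω, K, N, hu, hsec, hN⟩ := HeatKernel.exists_representing_operator j a ha_bdd ha_coer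
  have hinj := HeatKernel.injective_formResolvent hj hjd hu
  obtain ⟨S, D, hS⟩ := (hsec.formResolvent hu j).exists_isSmoothSemigroup hinj
    (HeatKernel.denseRange_formResolvent hj hjd hu)
  have hA := HeatKernel.mem_formOperator_graph_iff hj hjd hu hN
  have hjι : ∀ v, j v =ᵐ[μ] fun x => inner ℂ (d x) v := fun v => by
    simpa only [hd] using hιj v
  have hm : ∀ B, Measurable fun z : X × X => HeatKernel.resolventKernel j N d B z.1 z.2 :=
    fun B => by
      refine HeatKernel.measurable_evalKernel μ hdb (fun v => ?_) (fun v hv => hj ?_) _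
      · simpa only [hd] using hιm v
      · rw [map_zero, Lp.eq_zero_iff_ae_eq_zero]
        exact (hjι v).trans hv
  refine ⟨_, _, hS.isSemigroupGeneratedBy hA,
    HeatKernel.isHeatKernel_heatKernel hjι (fun t _ => hm _) hS hinj hA,
    HeatKernel.isKernelOf_heatKernel hjι hS hinj,
    fun t _ => HeatKernel.holderENorm_evalKernel_lt_top hdb hdα _, fun hsymm t ht => ?_⟩
  obtain ⟨h1, h2⟩ := HeatKernel.mixedHolder_heatKernel hjι hm
    (fun B => ⟨_, HeatKernel.holderWith_evalKernel hdb hdα _⟩) hS hinj hA ht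
  refine ⟨h1, fun hreal => h2 ?_ (HeatKernel.star_mem_formOperator_graph hj hjd ι hιj hreal)⟩
  rw [HeatKernel.adjoint_formResolvent, HeatKernel.adjoint_eq_of_formSymmetric hsymm hN]
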